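/- Let $p$ be a prime. A $p$-adic Banach space is a complete normed $\mathbf{Q}_p$-vector space $V$ with $|x+y|\le\max(|x|,|y|)$ and $|V|\subseteq|\mathbf{Q}_p|$. A $p$-adic field on $V$ is a series $a(z)=\sum_{n\in\mathbf{Z}}a(n)z^{-n-1}$ with continuous $\mathbf{Q}_p$-linear coefficients $a(n)\colon V\to V$ (its modes), uniformly bounded in operator norm, such that $a(n)b\to0$ as $n\to+\infty$ for every $b\in V$; the space $\mathcal{F}(V)$ of these carries the norm $\sup_n|a(n)|$. A $p$-adic vertex algebra is a $p$-adic Banach space $V$ with a vector $\mathbf{1}\in V$, $|\mathbf{1}|\le1$, and a continuous linear map $Y\colon V\to\mathcal{F}(V)$, $a\mapsto Y(a,z)=\sum_n a(n)z^{-n-1}$, such that $a(n)\mathbf{1}=0$ for $n\ge0$, $a(-1)\mathbf{1}=a$, and for all $u,v,w\in V$ and $r,s,t\in\mathbf{Z}$ $$\sum_{i\ge0}\binom{r}{i}(u(t+i)v)(r+s-i)w=\sum_{i\ge0}(-1)^i\binom{t}{i}\bigl\{u(r+t-i)v(s+i)w-(-1)^tv(s+t-i)u(r+i)w\bigr\},$$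 both series being convergent. It is submultiplicative if $|a(n)b|\le|a||b|$ for all $a,b\in V$ and $n\in\mathbf{Z}$. A $p$-adic VOA is a $p$-adic vertex algebra with a vector $\omega\in V$ and a scalar $c\in\mathbf{Q}_p$ (the central charge) such that the operators $L(n)=\omega(n+1)$ satisfy $[L(m),L(n)]=(m-n)L(m+n)+\delta_{m+n,0}\frac{m^3-m}{12}c\,\mathrm{id}_V$ and $[L(-1),Y(v,z)]=\partial_zY(v,z)$ for all $v\in V$, and such that the spaces $V_{(k)}=\{v: L(0)v=kv\}$, $k\in\mathbf{Z}$, are finite-dimensional, vanish for all sufficiently small $k$, and span a dense subspace of $V$. Let $S=\mathbf{Q}_p[h_{-1},h_{-2},\dots]$ be the rank-one Heisenberg VOA: for $n<0$ let $h_n$ act on $S$ by multiplication, for $n>0$ by $n\,\partial/\partial h_{-n}$, and let $h_0=0$; put $h(z)=\sum_n h_nz^{-n-1}$; the vacuum is $1$, the conformal vector is $\tfrac12h_{-1}^2$, and the products $a(n)b$ are given by the linear extension of $$Y(h_{-n_1}\cdots h_{-n_k},z)=\;:\tfrac{\partial_z^{n_1-1}h(z)}{(n_1-1)!}\cdots\tfrac{\partial_z^{n_k-1}h(z)}{(n_k-1)!}:$$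 (normally ordered product, nested from the right). Let $S_1$ be the Banach ring obtained by completing $S$ with respect to the sup-norm $|\sum_Ia_Ih^I|=\sup_I|a_I|$ on the monomial basis. **Proposition.** The Banach ring $S_1$ has a natural structure of submultiplicative $p$-adic VOA: there is a submultiplicative $p$-adic VOA structure on $S_1$ with vacuum $1$, conformal vector $\tfrac12h_{-1}^2$ and central charge $1$, whose products $a(n)b$ for $a,b\in S$ are those of the Heisenberg VOA $S$. Moreover, any $p$-adic VOA structure on $S_1$ whose products extend those of $S$ has the same vacuum and the same map $Y$. -/

import Mathlib

open Filter Topology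
open scoped NNReal

noncomputable section

/-! ### `p`-adic Banach spaces, `p`-adic fields and `p`-adic vertex operator algebras -/

/-- A `p`-adic Banach space: a complete ultrametric normed space over `ℚ_[p]` in which every norm
is the absolute value of an element of `ℚ_[p]`. -/
structure IsPadicBanachSpace (p : ℕ) [Fact p.Prime] (V : Type*) [NormedAddCommGroup V]
    [NormedSpace ℚ_[p] V] : Prop where
  complete : CompleteSpace V
  ultrametric : IsUltrametricDist V
  norm_mem : ∀ v : V, ∃ c : ℚ_[p], ‖v‖ = ‖c‖

/-- The space `𝓕(V)` of `p`-adic fields `a(z) = ∑ a(n) z^{-n-1}` on `V`: the sequences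
`(a(n))`, `n ∈ ℤ`, of continuous endomorphisms of `V` that are bounded in operator norm and satisfy
`a(n) b → 0` as `n → +∞`, for all `b`.  Its norm is `sup_n ‖a(n)‖`. -/
def PadicFields (p : ℕ) [Fact p.Prime] (V : Type*) [NormedAddCommGroup V] [NormedSpace ℚ_[p] V] :
    Submodule ℚ_[p] (BoundedContinuousFunction ℤ (V →L[ℚ_[p]] V)) where
  carrier := {A | ∀ b : V, Tendsto (fun n : ℤ => A n b) atTop (𝓝 0)}
  add_mem' := by
    intro A B hA hB b
    simpa using (hA b).add (hB b)
  zero_mem' := by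
    intro b
    simp
  smul_mem' := by
    intro c A hA b
    simpa using (hA b).const_smul c

/-- A `p`-adic vertex algebra `(V, Y, 𝟙)`. -/
structure PadicVertexAlgebra (p : ℕ) [Fact p.Prime] (V : Type*) [NormedAddCommGroup V]
    [NormedSpace ℚ_[p] V] where
  banach : IsPadicBanachSpace p V
  /-- the state-field correspondence -/
  Y : V →L[ℚ_[p]] PadicFields p V
  /-- the vacuum vector -/
  vacuum : V
  norm_vacuum_le : ‖vacuum‖ ≤ 1
  creation_nonneg : ∀ (a : V) (n : ℤ), 0 ≤ n → (Y a).1 n vacuum = 0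
  creation : ∀ a : V, (Y a).1 (-1) vacuum = a
  /-- the Jacobi identity: both series converge and have the same sum -/
  jacobi : ∀ (r s t : ℤ) (u v w : V), ∃ x : V,
    HasSum (fun i : ℕ => Ring.choose r i • (Y ((Y u).1 (t + i) v)).1 (r + s - i) w) x ∧
    HasSum (fun i : ℕ => ((-1 : ℤ) ^ i * Ring.choose t i) •
      ((Y u).1 (r + t - i) ((Y v).1 (s + i) w)
        - (t.negOnePow : ℤ) • (Y v).1 (s + t - i) ((Y u).1 (r + i) w))) x

/-- The `n`-th mode `a(n)` of a state `a`. -/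
def PadicVertexAlgebra.mode {p : ℕ} [Fact p.Prime] {V : Type*} [NormedAddCommGroup V]
    [NormedSpace ℚ_[p] V] (𝒱 : PadicVertexAlgebra p V) (a : V) (n : ℤ) : V →L[ℚ_[p]] V :=
  (𝒱.Y a).1 n

/-- `V` is submultiplicative if `|a(n) b| ≤ |a| |b|` for all `a`, `b`, `n`. -/
def PadicVertexAlgebra.IsSubmultiplicative {p : ℕ} [Fact p.Prime] {V : Type*}
    [NormedAddCommGroup V] [NormedSpace ℚ_[p] V] (𝒱 : PadicVertexAlgebra p V) : Prop :=
  ∀ (a b : V) (n : ℤ), ‖𝒱.mode a n b‖ ≤ ‖a‖ * ‖b‖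

/-- A weakly conformal `p`-adic vertex algebra `(V, Y, 𝟙, ω)` of central charge `c`; here
`Y(ω, z) = ∑ L(n) z^{-n-2}`, that is, `L(n) = ω(n+1)`. -/
structure WeaklyConformalPadicVertexAlgebra (p : ℕ) [Fact p.Prime] (V : Type*)
    [NormedAddCommGroup V] [NormedSpace ℚ_[p] V] extends PadicVertexAlgebra p V where
  /-- the conformal vector -/
  ω : V
  centralCharge : ℚ_[p]
  virasoro : ∀ m n : ℤ,
    toPadicVertexAlgebra.mode ω (m + 1) * toPadicVertexAlgebra.mode ω (n + 1)
      - toPadicVertexAlgebra.mode ω (n + 1) * toPadicVertexAlgebra.mode ω (m + 1)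
    = (m - n) • toPadicVertexAlgebra.mode ω (m + n + 1)
      + (if m + n = 0 then ((m : ℚ_[p]) ^ 3 - m) / 12 * centralCharge else 0) •
        (1 : V →L[ℚ_[p]] V)
  /-- `[L(-1), Y(v, z)] = ∂_z Y(v, z)`, mode by mode -/
  translation_covariance : ∀ (v : V) (n : ℤ),
    toPadicVertexAlgebra.mode ω 0 * toPadicVertexAlgebra.mode v n
      - toPadicVertexAlgebra.mode v n * toPadicVertexAlgebra.mode ω 0
    = (-n) • toPadicVertexAlgebra.mode v (n - 1)

/-- The Virasoro operator `L(n) = ω(n+1)`. -/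
def WeaklyConformalPadicVertexAlgebra.L {p : ℕ} [Fact p.Prime] {V : Type*} [NormedAddCommGroup V]
    [NormedSpace ℚ_[p] V] (𝒱 : WeaklyConformalPadicVertexAlgebra p V) (n : ℤ) :
    V →L[ℚ_[p]] V :=
  𝒱.mode 𝒱.ω (n + 1)

/-- The eigenspace `V_(k) = {v | L(0) v = k v}`. -/
def WeaklyConformalPadicVertexAlgebra.weightSpace {p : ℕ} [Fact p.Prime] {V : Type*}
    [NormedAddCommGroup V] [NormedSpace ℚ_[p] V] (𝒱 : WeaklyConformalPadicVertexAlgebra p V)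
    (k : ℤ) : Submodule ℚ_[p] V :=
  Module.End.eigenspace (𝒱.L 0 : V →ₗ[ℚ_[p]] V) (k : ℚ_[p])

/-- A `p`-adic vertex operator algebra: a weakly conformal `p`-adic vertex algebra whose integral
weight spaces are finite-dimensional, vanish for small weights, and span a dense subspace. -/
structure PadicVOA (p : ℕ) [Fact p.Prime] (V : Type*) [NormedAddCommGroup V]
    [NormedSpace ℚ_[p] V] extends WeaklyConformalPadicVertexAlgebra p V where
  finite_weightSpace : ∀ k : ℤ,
    FiniteDimensional ℚ_[p] (toWeaklyConformalPadicVertexAlgebra.weightSpace k)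
  weight_bounded_below : ∃ t : ℤ, ∀ k < t,
    toWeaklyConformalPadicVertexAlgebra.weightSpace k = ⊥
  dense_weightSpace :
    (⨆ k : ℤ, toWeaklyConformalPadicVertexAlgebra.weightSpace k).topologicalClosure = ⊤

/-! ### The Fock space `S = ℚ_p[h_{-1}, h_{-2}, …]` with its sup-norm -/

/-- The polynomial ring `ℚ_p[h_{-1}, h_{-2}, …]`; the variable `X i` is `h_{-(i+1)}`. -/
abbrev HeisenbergFock (p : ℕ) [Fact p.Prime] : Type := MvPolynomial ℕ ℚ_[p]

namespace HeisenbergFock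

variable {p : ℕ} [Fact p.Prime]

/-- The sup-norm with respect to the basis of monomials. -/
def supNorm (f : HeisenbergFock p) : ℝ := ((f.support.sup fun I => ‖f.coeff I‖₊ : ℝ≥0) : ℝ)

theorem norm_coeff_le (f : HeisenbergFock p) (I : ℕ →₀ ℕ) : ‖f.coeff I‖ ≤ supNorm f := by
  by_cases h : I ∈ f.support
  · exact_mod_cast Finset.le_sup (f := fun I => ‖f.coeff I‖₊) h
  · rw [MvPolynomial.notMem_support_iff.1 h, norm_zero]
    exact NNReal.coe_nonneg _

theorem supNorm_le_iff (f : HeisenbergFock p) {C : ℝ} (hC : 0 ≤ C) :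
    supNorm f ≤ C ↔ ∀ I, ‖f.coeff I‖ ≤ C := by
  refine ⟨fun h I => (norm_coeff_le f I).trans h, fun h => ?_⟩
  lift C to ℝ≥0 using hC
  have hs : (f.support.sup fun I => ‖f.coeff I‖₊) ≤ C :=
    Finset.sup_le fun I _ => by exact_mod_cast h I
  exact_mod_cast hs

theorem supNorm_nonneg (f : HeisenbergFock p) : 0 ≤ supNorm f := NNReal.coe_nonneg _

theorem supNorm_add_le_max (f g : HeisenbergFock p) :
    supNorm (f + g) ≤ max (supNorm f) (supNorm g) := by
  rw [supNorm_le_iff _ (le_max_of_le_left (supNorm_nonneg f))]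
  intro I
  rw [MvPolynomial.coeff_add]
  exact (IsUltrametricDist.norm_add_le_max _ _).trans (max_le_max (norm_coeff_le f I) (norm_coeff_le g I))

theorem supNorm_mul_le (f g : HeisenbergFock p) : supNorm (f * g) ≤ supNorm f * supNorm g := by
  have h0 : 0 ≤ supNorm f * supNorm g := mul_nonneg (supNorm_nonneg f) (supNorm_nonneg g)
  rw [supNorm_le_iff _ h0]
  intro I
  rw [MvPolynomial.coeff_mul]
  refine IsUltrametricDist.norm_sum_le_of_forall_le_of_nonneg h0 fun x _ => ?_
  rw [norm_mul]
  exact mul_le_mul (norm_coeff_le f _) (norm_coeff_le g _) (norm_nonneg _) (supNorm_nonneg f)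

/-- The sup-norm as a norm on the additive group of `S`. -/
def addGroupNorm (p : ℕ) [Fact p.Prime] : AddGroupNorm (HeisenbergFock p) where
  toFun := supNorm
  map_zero' := by simp [supNorm]
  add_le' f g := (supNorm_add_le_max f g).trans
    (max_le_add_of_nonneg (supNorm_nonneg f) (supNorm_nonneg g))
  neg' f := by simp [supNorm]
  eq_zero_of_map_eq_zero' f hf := by
    ext I
    rw [MvPolynomial.coeff_zero, ← norm_le_zero_iff]
    exact (norm_coeff_le f I).trans hf.le

theorem supNorm_smul_le (c : ℚ_[p]) (f : HeisenbergFock p) :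
    supNorm (c • f) ≤ ‖c‖ * supNorm f := by
  rw [supNorm_le_iff _ (mul_nonneg (norm_nonneg c) (supNorm_nonneg f))]
  intro I
  rw [MvPolynomial.coeff_smul, smul_eq_mul, norm_mul]
  exact mul_le_mul_of_nonneg_left (norm_coeff_le f I) (norm_nonneg c)

end HeisenbergFock

/-- The ring `S`, as a type of its own, so that its topology is the one given by the sup-norm. -/
def NormedHeisenbergFock (p : ℕ) [Fact p.Prime] : Type := HeisenbergFock p

namespace NormedHeisenbergFock

variable {p : ℕ} [Fact p.Prime]

instance : NormedCommRing (NormedHeisenbergFock p) where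
  __ := (HeisenbergFock.addGroupNorm p).toNormedAddCommGroup
  __ := (inferInstance : CommRing (MvPolynomial ℕ ℚ_[p]))
  norm_mul_le := HeisenbergFock.supNorm_mul_le

instance : NormedAlgebra ℚ_[p] (NormedHeisenbergFock p) where
  __ := (inferInstance : Algebra ℚ_[p] (MvPolynomial ℕ ℚ_[p]))
  norm_smul_le := HeisenbergFock.supNorm_smul_le

/-- The identity map of `S`. -/
def ofFock (p : ℕ) [Fact p.Prime] : HeisenbergFock p ≃ₐ[ℚ_[p]] NormedHeisenbergFock p :=
  (AlgEquiv.refl : MvPolynomial ℕ ℚ_[p] ≃ₐ[ℚ_[p]] MvPolynomial ℕ ℚ_[p])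

theorem norm_ofFock (f : HeisenbergFock p) : ‖ofFock p f‖ = HeisenbergFock.supNorm f := rfl

end NormedHeisenbergFock

/-- The Banach ring `S_1`: the completion of `S` with respect to the sup-norm. -/
abbrev HeisenbergCompletion (p : ℕ) [Fact p.Prime] : Type :=
  UniformSpace.Completion (NormedHeisenbergFock p)

/-- The canonical map `S → S_1`. -/
def HeisenbergFock.toCompletion {p : ℕ} [Fact p.Prime] (a : HeisenbergFock p) :
    HeisenbergCompletion p :=
  (NormedHeisenbergFock.ofFock p a : UniformSpace.Completion (NormedHeisenbergFock p))

namespace HeisenbergFock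

variable {p : ℕ} [Fact p.Prime]

/-! ### The Heisenberg vertex operator algebra structure on `S`

A formal field `A(z) = ∑ A_n z^{-n-1}` on `S` is given by its sequence of modes `A_n : S → S`. -/

/-- The action of the Heisenberg Lie algebra: `h_n` is `n ∂/∂h_{-n}` for `n > 0`, is
multiplication by `h_n` for `n < 0`, and `h_0 = 0`.  These are the modes of the generating field
`h(z) = ∑ h_n z^{-n-1}`. -/
def h : ℤ → HeisenbergFock p → HeisenbergFock p
  | Int.ofNat 0 => fun _ => 0
  | Int.ofNat (k + 1) => fun b => ((k : ℚ_[p]) + 1) • MvPolynomial.pderiv k b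
  | Int.negSucc k => fun b => MvPolynomial.X k * b

/-- The identity field: its only non-zero mode is the `(-1)`-st one. -/
def idField : ℤ → HeisenbergFock p → HeisenbergFock p :=
  fun n b => if n = -1 then b else 0

/-- The divided derivative `(1/j!) ∂_z^j A(z)`; the coefficient of `z^{-s-1}` in it is
`(-1)^j * choose s j * A_{s-j}`. -/
def divDeriv (j : ℕ) (A : ℤ → HeisenbergFock p → HeisenbergFock p) :
    ℤ → HeisenbergFock p → HeisenbergFock p :=
  fun s b => ((-1 : ℤ) ^ j * Ring.choose s j) • A (s - j) b

/-- The normally ordered product `:A(z)B(z): = A(z)₊ B(z) + B(z) A(z)₋`, where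
`A(z)₊ = ∑_{n < 0} A_n z^{-n-1}` and `A(z)₋ = ∑_{n ≥ 0} A_n z^{-n-1}`.  On the fields below, all
but finitely many terms vanish. -/
def normalOrdered (A B : ℤ → HeisenbergFock p → HeisenbergFock p) :
    ℤ → HeisenbergFock p → HeisenbergFock p :=
  fun s b => (∑ᶠ k : ℕ, A (-1 - k) (B (s + k) b)) + ∑ᶠ k : ℕ, B (s - 1 - k) (A k b)

/-- The vertex operator of a monomial: the field of `h_{-n_1} ⋯ h_{-n_k}` (with multiplicities
allowed) is the normally ordered product, nested from the right, of the fields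
`(1/(n_i - 1)!) ∂_z^{n_i - 1} h(z)`. -/
def monomialField (I : ℕ →₀ ℕ) : ℤ → HeisenbergFock p → HeisenbergFock p :=
  (Finsupp.toMultiset I).sort.foldr (fun j B => normalOrdered (divDeriv j h) B) idField

/-- The product `a(n) b` of the Heisenberg vertex algebra `S`. -/
def modeProduct (a : HeisenbergFock p) (n : ℤ) (b : HeisenbergFock p) : HeisenbergFock p :=
  ∑ I ∈ a.support, a.coeff I • monomialField I n b

/-- The conformal vector `ω = (1/2) h_{-1}^2` of `S`. -/
def conformalVector (p : ℕ) [Fact p.Prime] : HeisenbergFock p :=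
  (1 / 2 : ℚ_[p]) • MvPolynomial.X 0 ^ 2

end HeisenbergFock

end

/-! The structure constants of the Heisenberg VOA are integral: `h n` multiplies by a variable, or
differentiates and multiplies by an integer, and divided derivatives only bring in integer binomial
coefficients. Hence no mode of a monomial increases the sup-norm (`isFormalField_monomialField`), so
|a(n)b| ≤ |a||b| on S (`supNorm_mode_le`), and the products extend to S_1 by continuity.

The main work is the Jacobi identity on S. Nested normal ordering does not depend on the order of
the factors (`normalOrdered_left_comm`), which gives a recursion for the modes of X_j a
(`exists_mode_X_mul_eq`) and from it the commutator formula [h_m, a(n)] = ∑ (m choose j) (h_j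
a)(m+n-j) (`h_mode`). Two facts then replace residue calculus. A linear operator commuting with
every h_m is a scalar, read off from the constant term of its value at 1 (`isLinearMap_eq_smul`).
Every vector is killed by all sufficiently long words in the h_j, j ≥ 0 (`annihilation_induction`).
So identities can be proved by induction: the commutator of h_m with the defect of an identity
involves only the defects for h_j u or h_j v, which vanish by hypothesis, so the defect is a scalar.
This first yields [L(-1), v(n)] = -n v(n-1).

For Jacobi the scalars c(r,s,t) satisfy c(r+1,s,t) = c(r,s+1,t) + c(r,s,t+1). They also satisfy r
c(r-1,s,t) + s c(r,s-1,t) = 0, because L(-1) kills 1 and its image has no constant terms. Together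
with the creation axiom at (r,s) = (0,-1) and skew-symmetry of constant terms at r = -1, s ≥ 0,
these relations force c = 0 (`jacobiDefect_eq_zero`). The Virasoro relations follow from the
products ω(i)ω.

On S_1, the termwise differences of the two sides of Jacobi sum to zero, which is a closed condition
under uniform bounds; one side converges because its terms tend to zero. The coefficients extend to
continuous functionals that separate points, and L(0) scales the coefficient of h^I by the weight of
I, so an element of a weight space is determined by finitely many coefficients. Uniqueness is
density of S together with continuity. -/

/-! ### Finitely supported sums over ℕ -/

section SumsOverNat

variable {M : Type*} [AddCommGroup M]

theorem hasFiniteSupport_of_forall_le {f : ℕ → M} {N : ℕ} (hf : ∀ i, N ≤ i → f i = 0) :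
    f.HasFiniteSupport :=
  (Set.finite_Iio N).subset fun i hi => by
    by_contra h
    exact hi (hf i (not_lt.1 h))

theorem finsum_eq_sum_range {f : ℕ → M} {N : ℕ} (hf : ∀ i, N ≤ i → f i = 0) :
    ∑ᶠ i, f i = ∑ i ∈ Finset.range N, f i := by
  refine finsum_eq_sum_of_support_subset f fun i hi => ?_
  by_contra h
  exact hi (hf i (by simpa using h))

theorem finsum_eq_zero_add {f : ℕ → M} (hf : f.HasFiniteSupport) :
    ∑ᶠ i, f i = f 0 + ∑ᶠ i, f (i + 1) := by
  obtain ⟨N, hN⟩ := hf.bddAbove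
  have h : ∀ i, N + 1 ≤ i → f i = 0 := fun i hi => by
    by_contra h
    have := hN h
    omega
  rw [finsum_eq_sum_range (N := N + 2) fun i hi => h i (by omega),
    finsum_eq_sum_range (N := N + 1) fun i hi => h (i + 1) (by omega), Finset.sum_range_succ', add_comm]

theorem finsum_eq_finsum_add_nat {f : ℕ → M} {k : ℕ} (hf : ∀ i < k, f i = 0) :
    ∑ᶠ i, f i = ∑ᶠ i, f (i + k) := by
  have hinj : Function.Injective fun i : ℕ => i + k := add_left_injective k
  rw [← finsum_mem_range (f := f) hinj, ← finsum_mem_univ]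
  refine finsum_mem_inter_support_eq f _ _ ?_
  ext i
  simp only [Set.univ_inter, Set.mem_inter_iff, Function.mem_support, Set.mem_range, ne_eq,
    iff_and_self]
  intro h
  refine ⟨i - k, Nat.sub_add_cancel ?_⟩
  by_contra h'
  exact h (hf i (by omega))

end SumsOverNat

/-! ### Binomial sums of truncated double sequences -/

section BinomialSums

variable {M M' : Type*} [AddCommGroup M] [AddCommGroup M']

/-- The sum `∑ ε^i (a choose i) f(b + i, a + c - i)` over `i ≥ 0`. -/
noncomputable def binomialSum (ε : ℤ) (f : ℤ → ℤ → M) (a b c : ℤ) : M :=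
  ∑ᶠ i : ℕ, (ε ^ i * Ring.choose a i) • f (b + i) (a + c - i)

/-- `f` vanishes when its first argument is large, uniformly in the second. -/
def IsTruncated (f : ℤ → ℤ → M) : Prop :=
  ∃ N : ℤ, ∀ b, N ≤ b → ∀ c, f b c = 0

namespace IsTruncated

variable {f g : ℤ → ℤ → M}

theorem add (hf : IsTruncated f) (hg : IsTruncated g) :
    IsTruncated fun b c => f b c + g b c := by
  obtain ⟨N, hN⟩ := hf
  obtain ⟨N', hN'⟩ := hg
  exact ⟨max N N', fun b hb c => by
    simp only [hN b (le_of_max_le_left hb), hN' b (le_of_max_le_right hb), add_zero]⟩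

theorem zsmul (hf : IsTruncated f) (k : ℤ → ℤ → ℤ) : IsTruncated fun b c => k b c • f b c := by
  obtain ⟨N, hN⟩ := hf
  exact ⟨N, fun b hb c => by simp only [hN b hb, smul_zero]⟩

theorem sum {ι : Type*} {f : ι → ℤ → ℤ → M} (s : Finset ι) (hf : ∀ j ∈ s, IsTruncated (f j)) :
    IsTruncated fun b c => ∑ j ∈ s, f j b c := by
  classical
  induction s using Finset.induction_on with
  | empty => exact ⟨0, fun b _ c => by simp⟩
  | insert j s hj ih =>
    simp only [Finset.sum_insert hj]
    exact (hf j (by simp)).add (ih fun i hi => hf i (by simp [hi]))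

theorem shift (hf : IsTruncated f) (x y : ℤ) : IsTruncated fun b c => f (b + x) (c + y) := by
  obtain ⟨N, hN⟩ := hf
  exact ⟨N - x, fun b hb c => hN _ (by omega) _⟩

theorem hasFiniteSupport (hf : IsTruncated f) (k : ℕ → ℤ) (b : ℤ) (c : ℕ → ℤ) :
    (fun i : ℕ => k i • f (b + i) (c i)).HasFiniteSupport := by
  obtain ⟨N, hN⟩ := hf
  refine hasFiniteSupport_of_forall_le (N := (N - b).toNat) fun i hi => ?_
  rw [hN _ (by omega), smul_zero]

end IsTruncated

variable {f g : ℤ → ℤ → M} {ε : ℤ}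

theorem binomialSum_eq_zero {N : ℤ} (hN : ∀ b, N ≤ b → ∀ c, f b c = 0) {b : ℤ} (hb : N ≤ b)
    (a c : ℤ) : binomialSum ε f a b c = 0 := by
  have : ∀ i : ℕ, (ε ^ i * Ring.choose a i) • f (b + i) (a + c - i) = 0 := fun i => by
    rw [hN _ (by omega), smul_zero]
  simp [binomialSum, this]

theorem IsTruncated.binomialSum (hf : IsTruncated f) (ε : ℤ) (a : ℤ) :
    IsTruncated fun b c => binomialSum ε f a b c := by
  obtain ⟨N, hN⟩ := hf
  exact ⟨N, fun b hb c => binomialSum_eq_zero hN hb a c⟩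

theorem binomialSum_add (hf : IsTruncated f) (hg : IsTruncated g) (a b c : ℤ) :
    binomialSum ε (fun b c => f b c + g b c) a b c = binomialSum ε f a b c + binomialSum ε g a b c := by
  simp only [binomialSum, smul_add]
  exact finsum_add_distrib (hf.hasFiniteSupport _ _ _) (hg.hasFiniteSupport _ _ _)

theorem map_binomialSum (hf : IsTruncated f) (φ : M →+ M') (a b c : ℤ) :
    φ (binomialSum ε f a b c) = binomialSum ε (fun b c => φ (f b c)) a b c := by
  rw [binomialSum, map_finsum φ (hf.hasFiniteSupport _ _ _)]
  simp only [map_zsmul, binomialSum]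

theorem binomialSum_sub (hf : IsTruncated f) (hg : IsTruncated g) (a b c : ℤ) :
    binomialSum ε (fun b c => f b c - g b c) a b c = binomialSum ε f a b c - binomialSum ε g a b c := by
  simp only [binomialSum, smul_sub]
  exact finsum_sub_distrib (hf.hasFiniteSupport _ _ _) (hg.hasFiniteSupport _ _ _)

theorem binomialSum_zsmul (hf : IsTruncated f) (k : ℤ) (a b c : ℤ) :
    binomialSum ε (fun b c => k • f b c) a b c = k • binomialSum ε f a b c :=
  (map_binomialSum hf (zsmulAddGroupHom k) a b c).symm

theorem binomialSum_sum {ι : Type*} {f : ι → ℤ → ℤ → M} (s : Finset ι)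
    (hf : ∀ j ∈ s, IsTruncated (f j)) (a b c : ℤ) :
    binomialSum ε (fun b c => ∑ j ∈ s, f j b c) a b c = ∑ j ∈ s, binomialSum ε (f j) a b c := by
  simp only [binomialSum, Finset.smul_sum]
  exact finsum_sum_comm s _ fun j hj => (hf j hj).hasFiniteSupport _ _ _

theorem binomialSum_shift (x y a b c : ℤ) :
    binomialSum ε (fun b c => f (b + x) (c + y)) a b c = binomialSum ε f a (b + x) (c + y) := by
  refine finsum_congr fun i => ?_
  rw [show b + x + (i : ℤ) = b + i + x by ring, show a + (c + y) - (i : ℤ) = a + c - i + y by ring]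

theorem binomialSum_zero (b c : ℤ) : binomialSum ε f 0 b c = f b c := by
  rw [binomialSum, finsum_eq_single _ 0]
  · simp
  · intro i hi
    rw [Ring.choose_zero_pos ℤ (Nat.pos_of_ne_zero hi)]
    simp

/-- Pascal's rule. Formally, `binomialSum ε f a` is (S_c + ε S_b)^a f for the two index shifts,
expanded in powers of S_b; this lemma peels off one factor, for negative exponents too. -/
theorem binomialSum_succ (hf : IsTruncated f) (a b c : ℤ) :
    binomialSum ε f (a + 1) b c
      = binomialSum ε f a b (c + 1) + ε • binomialSum ε f a (b + 1) c := by
  have h := hf.hasFiniteSupport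
  rw [binomialSum, finsum_eq_zero_add (h _ _ _), binomialSum, finsum_eq_zero_add (h _ _ _),
    binomialSum, smul_finsum' _ (h _ _ _), add_assoc (_ • f _ _), ← finsum_add_distrib]
  · congr 1
    · simp only [pow_zero, Ring.choose_zero_right, Nat.cast_zero]
      congr 2; ring
    · refine finsum_congr fun i => ?_
      rw [Ring.choose_succ_succ, mul_add, add_smul, smul_smul, add_comm]
      congr 1
      · congr 2; push_cast; ring
      · rw [pow_succ', mul_assoc]
        congr 2 <;> push_cast <;> ring
  · obtain ⟨N, hN⟩ := hf
    exact hasFiniteSupport_of_forall_le (N := (N - b).toNat) fun i hi => by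
      rw [hN _ (by push_cast; omega), smul_zero]
  · obtain ⟨N, hN⟩ := hf
    exact hasFiniteSupport_of_forall_le (N := (N - b).toNat) fun i hi => by
      rw [hN _ (by omega), smul_zero, smul_zero]

/-- A family that satisfies the recursion of binomial sums, vanishes for large `b` and vanishes
for `a = 0` is zero. -/
theorem eq_zero_of_binomial_recursion {F : ℤ → ℤ → ℤ → M}
    (hrec : ∀ a b c, F (a + 1) b c = F a b (c + 1) + ε • F a (b + 1) c)
    (h0 : ∀ b c, F 0 b c = 0) {N : ℤ} (hN : ∀ a b, N ≤ b → ∀ c, F a b c = 0) (a b c : ℤ) :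
    F a b c = 0 := by
  induction a using Int.induction_on generalizing b c with
  | zero => exact h0 b c
  | succ a ih => rw [hrec, ih, ih, smul_zero, add_zero]
  | pred a ih =>
    -- For negative `a` the recursion is solved for its middle term, which raises `b`; truncation
    -- ends this after `k` steps.
    obtain ⟨k, hk⟩ : ∃ k : ℕ, N ≤ b + k := ⟨(N - b).toNat, by omega⟩
    induction k generalizing b c with
    | zero => exact hN _ b (by simpa using hk) c
    | succ k ihk =>
      have h := hrec (-a - 1) b (c - 1)
      rw [sub_add_cancel, ih, sub_add_cancel, ihk (b + 1) _ (by push_cast at hk; omega), smul_zero, add_zero] at h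
      exact h.symm

theorem eq_binomialSum (hf : IsTruncated f) {F : ℤ → ℤ → ℤ → M}
    (hrec : ∀ a b c, F (a + 1) b c = F a b (c + 1) + ε • F a (b + 1) c)
    (h0 : ∀ b c, F 0 b c = f b c) {N : ℤ} (hN : ∀ a b, N ≤ b → ∀ c, F a b c = 0) (a b c : ℤ) :
    F a b c = binomialSum ε f a b c := by
  obtain ⟨N', hN'⟩ := id hf
  refine sub_eq_zero.1 (eq_zero_of_binomial_recursion (ε := ε)
    (F := fun a b c => F a b c - binomialSum ε f a b c) (N := max N N') ?_ ?_ ?_ a b c)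
  · intro a b c
    simp only [hrec, binomialSum_succ hf, smul_sub]
    abel
  · intro b c
    rw [h0, binomialSum_zero, sub_self]
  · intro a b hb c
    simp only [hN a b (le_of_max_le_left hb), binomialSum_eq_zero hN' (le_of_max_le_right hb), sub_zero]

/-- The exponents of S_c + ε S_b add. This is Vandermonde's identity, obtained without computing:
both sides obey the same recursion in `a'` with the same value at 0. -/
theorem binomialSum_binomialSum (hf : IsTruncated f) (a a' b c : ℤ) :
    binomialSum ε (fun b c => binomialSum ε f a b c) a' b c = binomialSum ε f (a' + a) b c := by
  obtain ⟨N, hN⟩ := id hf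
  refine (eq_binomialSum (F := fun a' b c => binomialSum ε f (a' + a) b c)
    (hf.binomialSum ε a) ?_ ?_ (N := N) ?_ a' b c).symm
  · intro a' b c
    rw [add_right_comm, binomialSum_succ hf]
  · intro b c
    rw [zero_add]
  · intro a' b hb c
    exact binomialSum_eq_zero hN hb _ _

theorem succ_mul_choose_succ (a : ℤ) (i : ℕ) :
    ((i : ℤ) + 1) * Ring.choose a (i + 1) = a * Ring.choose (a - 1) i := by
  simpa using Ring.choose_smul_choose a (Nat.le_add_left 1 i)

theorem succ_mul_choose_succ' (a : ℤ) (i : ℕ) :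
    ((i : ℤ) + 1) * Ring.choose a (i + 1) = (a - i) * Ring.choose a i := by
  have h := Ring.choose_smul_choose a (Nat.le_succ i)
  simp only [Nat.succ_eq_add_one, Nat.choose_succ_self_right, nsmul_eq_mul, Nat.cast_add, Nat.cast_one] at h
  rw [h, Nat.add_sub_cancel_left, Ring.choose_one_right, mul_comm]

theorem sub_mul_choose (a : ℤ) (i : ℕ) :
    (a - i) * Ring.choose a i = a * Ring.choose (a - 1) i := by
  rw [← succ_mul_choose_succ', succ_mul_choose_succ]

/-- Shifting the summation index by `k` turns the weights `(m choose j) (j choose k)` into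
`(m choose k) (m - k choose j)`. -/
theorem finsum_choose_mul_choose_smul {g : ℤ → ℤ → M} (hg : IsTruncated g) (m b c : ℤ) (k : ℕ) :
    ∑ᶠ j : ℕ, (Ring.choose m j * Ring.choose (j : ℤ) k) • g (b + j - k) (m + c - j)
      = Ring.choose m k • binomialSum 1 g (m - k) b c := by
  rw [finsum_eq_finsum_add_nat (k := k), binomialSum, smul_finsum' _ (hg.hasFiniteSupport _ _ _)]
  · refine finsum_congr fun i => ?_
    have h := Ring.choose_smul_choose m (Nat.le_add_left k i)
    rw [Nat.add_sub_cancel] at h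
    rw [smul_smul, Ring.choose_natCast, one_pow, one_mul, ← h, nsmul_eq_mul, mul_comm]
    congr 2 <;> push_cast <;> ring
  · intro i hi
    rw [Ring.choose_natCast, Nat.choose_eq_zero_of_lt hi, Nat.cast_zero, mul_zero, zero_smul]

/-- The effect of a derivation: the terms in which it hits the binomial weights. -/
theorem binomialSum_neg_one_derivation (hf : IsTruncated f) (a b c : ℤ) :
    binomialSum (-1) (fun b c => c • f b (c - 1) + b • f (b - 1) c) a b c
      = c • binomialSum (-1) f a b (c - 1) + b • binomialSum (-1) f a (b - 1) c := by
  obtain ⟨N, hN⟩ := hf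
  have h1 : ∀ i : ℕ, (N - b).toNat + 1 ≤ i → ∀ x, f (b - 1 + i) x = 0 := fun i hi x =>
    hN _ (by omega) _
  have h1' : ∀ i : ℕ, (N - b).toNat + 1 ≤ i → ∀ x, f (b + i - 1) x = 0 := fun i hi x =>
    hN _ (by omega) _
  have h2 : ∀ i : ℕ, (N - b).toNat + 1 ≤ i → ∀ x, f (b + i) x = 0 := fun i hi x =>
    hN _ (by omega) _
  simp only [binomialSum]
  rw [finsum_eq_sum_range (N := (N - b).toNat + 1) fun i hi => by
      rw [h1' i hi, h2 i hi, smul_zero, smul_zero, add_zero, smul_zero],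
    finsum_eq_sum_range (N := (N - b).toNat + 1) fun i hi => by rw [h2 i hi, smul_zero],
    finsum_eq_sum_range (N := (N - b).toNat + 1) fun i hi => by rw [h1 i hi, smul_zero]]
  rw [Finset.smul_sum, Finset.smul_sum, ← Finset.sum_add_distrib, ← sub_eq_zero,
    ← Finset.sum_sub_distrib]
  set K := (N - b).toNat
  -- The excess coefficients a - i and i telescope because (a - i)(a choose i) = (i + 1)(a choose i
  -- + 1) and the signs alternate. The lower boundary term has the factor 0; the upper one vanishes
  -- by truncation.
  have htel : ∀ i : ℕ, ((-1 : ℤ) ^ i * Ring.choose a i) • ((a + c - i) • f (b + i) (a + c - i - 1)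
        + (b + i) • f (b + i - 1) (a + c - i))
      - (c • ((-1 : ℤ) ^ i * Ring.choose a i) • f (b + i) (a + (c - 1) - i)
        + b • ((-1 : ℤ) ^ i * Ring.choose a i) • f (b - 1 + i) (a + c - i))
      = ((-1 : ℤ) ^ i * ((i : ℤ) * Ring.choose a i)) • f (b + i - 1) (a + c - i)
        - ((-1 : ℤ) ^ (i + 1) * (((i + 1 : ℕ) : ℤ) * Ring.choose a (i + 1)))
          • f (b + (i + 1 : ℕ) - 1) (a + c - (i + 1 : ℕ)) := fun i => by
    have e1 : a + (c - 1) - (i : ℤ) = a + c - i - 1 := by ring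
    have e2 : b - 1 + (i : ℤ) = b + i - 1 := by ring
    have e3 : b + ((i + 1 : ℕ) : ℤ) - 1 = b + i := by push_cast; ring
    have e4 : a + c - ((i + 1 : ℕ) : ℤ) = a + c - i - 1 := by push_cast; ring
    have e5 : (((i + 1 : ℕ) : ℤ) * Ring.choose a (i + 1)) = (a - i) * Ring.choose a i := by
      rw [← succ_mul_choose_succ']; push_cast; ring
    rw [e1, e2, e3, e4, e5]
    module
  rw [Finset.sum_congr rfl fun i _ => htel i, Finset.sum_range_sub']
  have : f (b + ((K + 1 : ℕ) : ℤ) - 1) (a + c - ((K + 1 : ℕ) : ℤ)) = 0 := h1' _ le_rfl _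
  rw [this]
  simp

/-- Here only the second index is differentiated. Its weight a + c - i splits as c + (a - i), and (a
- i)(a choose i) = a (a - 1 choose i). -/
theorem binomialSum_one_derivation (hf : IsTruncated f) (a b c : ℤ) :
    binomialSum 1 (fun b c => c • f b (c - 1)) a b c
      = a • binomialSum 1 f (a - 1) b c + c • binomialSum 1 f a b (c - 1) := by
  have h := hf.hasFiniteSupport
  simp only [binomialSum]
  rw [smul_finsum' _ (h _ _ _), smul_finsum' _ (h _ _ _), ← finsum_add_distrib]
  · refine finsum_congr fun i => ?_
    have e1 : a - 1 + c - (i : ℤ) = a + c - i - 1 := by ring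
    have e2 : a + (c - 1) - (i : ℤ) = a + c - i - 1 := by ring
    rw [e1, e2, smul_smul, smul_smul, smul_smul, ← add_smul]
    congr 1
    rw [mul_left_comm a, ← sub_mul_choose]
    ring
  · obtain ⟨N, hN⟩ := hf
    exact hasFiniteSupport_of_forall_le (N := (N - b).toNat) fun i hi => by
      rw [hN _ (by omega), smul_zero, smul_zero]
  · obtain ⟨N, hN⟩ := hf
    exact hasFiniteSupport_of_forall_le (N := (N - b).toNat) fun i hi => by
      rw [hN _ (by omega), smul_zero, smul_zero]

end BinomialSums

/-! ### The Heisenberg operators and their norms -/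

namespace HeisenbergFock

variable {p : ℕ} [Fact p.Prime]

theorem supNorm_zero : supNorm (0 : HeisenbergFock p) = 0 := by simp [supNorm]

theorem supNorm_zsmul_le (n : ℤ) (f : HeisenbergFock p) : supNorm (n • f) ≤ supNorm f := by
  rw [← Int.cast_smul_eq_zsmul ℚ_[p]]
  exact (supNorm_smul_le _ f).trans
    (mul_le_of_le_one_left (supNorm_nonneg f) (Padic.norm_int_le_one n))

theorem supNorm_sum_le {ι : Type*} (s : Finset ι) (f : ι → HeisenbergFock p) {C : ℝ} (hC : 0 ≤ C)
    (hf : ∀ i ∈ s, supNorm (f i) ≤ C) : supNorm (∑ i ∈ s, f i) ≤ C := by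
  classical
  induction s using Finset.induction_on with
  | empty => simpa [supNorm_zero] using hC
  | insert j s hj ih =>
    rw [Finset.sum_insert hj]
    exact (supNorm_add_le_max _ _).trans
      (max_le (hf j (by simp)) (ih fun i hi => hf i (by simp [hi])))

theorem h_zero (b : HeisenbergFock p) : h 0 b = 0 := rfl

theorem h_succ (k : ℕ) (b : HeisenbergFock p) :
    h ((k : ℤ) + 1) b = ((k : ℤ) + 1) • MvPolynomial.pderiv k b := by
  rw [← Int.cast_smul_eq_zsmul ℚ_[p]]
  push_cast
  rfl

theorem h_neg (k : ℕ) (b : HeisenbergFock p) : h (-1 - (k : ℤ)) b = MvPolynomial.X k * b := by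
  rw [show -1 - (k : ℤ) = Int.negSucc k by omega]
  rfl

/-- Every integer is `0`, `k + 1` or `-1 - k` for a natural number `k`. -/
theorem int_trichotomy (n : ℤ) : n = 0 ∨ (∃ k : ℕ, n = k + 1) ∨ ∃ k : ℕ, n = -1 - k := by
  rcases lt_trichotomy n 0 with h | h | h
  · exact Or.inr (Or.inr ⟨(-1 - n).toNat, by omega⟩)
  · exact Or.inl h
  · exact Or.inr (Or.inl ⟨(n - 1).toNat, by omega⟩)

theorem isLinearMap_h (n : ℤ) : IsLinearMap ℚ_[p] (h n : HeisenbergFock p → HeisenbergFock p) := by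
  obtain rfl | ⟨k, rfl⟩ | ⟨k, rfl⟩ := int_trichotomy n
  · exact ⟨fun _ _ => (add_zero _).symm, fun _ _ => (smul_zero _).symm⟩
  · exact ⟨fun x y => by simp only [h_succ, map_add, smul_add],
      fun c x => by rw [h_succ, h_succ, Derivation.map_smul, smul_comm]⟩
  · exact ⟨fun x y => by simp only [h_neg, mul_add], fun c x => by
      rw [h_neg, h_neg, mul_smul_comm]⟩

/-- `h n` as a linear map. -/
noncomputable def hLin (n : ℤ) : HeisenbergFock p →ₗ[ℚ_[p]] HeisenbergFock p := (isLinearMap_h n).mk' _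

theorem hLin_apply (n : ℤ) (b : HeisenbergFock p) : hLin n b = h n b := rfl

theorem pderiv_pderiv_comm (i j : ℕ) (b : HeisenbergFock p) :
    MvPolynomial.pderiv i (MvPolynomial.pderiv j b)
      = MvPolynomial.pderiv j (MvPolynomial.pderiv i b) := by
  have h : ⁅(MvPolynomial.pderiv i : Derivation ℚ_[p] (HeisenbergFock p) (HeisenbergFock p)),
      (MvPolynomial.pderiv j : Derivation ℚ_[p] (HeisenbergFock p) (HeisenbergFock p))⁆ = 0 := by
    refine MvPolynomial.derivation_ext fun k => ?_
    classical
    simp only [Derivation.commutator_apply, MvPolynomial.pderiv_X, Pi.single_apply,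
      Derivation.coe_zero, Pi.zero_apply]
    split_ifs <;> simp
  rw [← sub_eq_zero, ← Derivation.commutator_apply, h, Derivation.coe_zero, Pi.zero_apply]

/-- The Heisenberg relations. -/
theorem h_commutator (m n : ℤ) (b : HeisenbergFock p) :
    h m (h n b) - h n (h m b) = if m + n = 0 then m • b else 0 := by
  have key : ∀ (k l : ℕ) (b : HeisenbergFock p), h ((k : ℤ) + 1) (h (-1 - (l : ℤ)) b)
      - h (-1 - (l : ℤ)) (h ((k : ℤ) + 1) b)
      = if k = l then ((k : ℤ) + 1) • b else 0 := by
    intro k l b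
    classical
    simp only [h_neg, h_succ, Derivation.leibniz, smul_eq_mul, MvPolynomial.pderiv_X,
      Pi.single_apply, smul_add, mul_smul_comm, add_sub_cancel_left, eq_comm (a := k)]
    split_ifs <;> simp
  have h0 : ∀ n : ℤ, h n (0 : HeisenbergFock p) = 0 := fun n => (hLin n).map_zero
  obtain rfl | ⟨k, rfl⟩ | ⟨k, rfl⟩ := int_trichotomy m
  · rw [h_zero, h_zero, h0, zero_smul, ite_self, sub_self]
  · obtain rfl | ⟨l, rfl⟩ | ⟨l, rfl⟩ := int_trichotomy n
    · rw [h_zero, h_zero, h0, sub_self, if_neg (by omega)]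
    · rw [if_neg (by omega)]
      simp only [h_succ, map_zsmul, pderiv_pderiv_comm k l, smul_comm ((k : ℤ) + 1), sub_self]
    · rw [key]
      exact if_congr (by omega) rfl rfl
  · obtain rfl | ⟨l, rfl⟩ | ⟨l, rfl⟩ := int_trichotomy n
    · rw [h_zero, h_zero, h0, sub_self, if_neg (by omega)]
    · rw [← neg_sub, key]
      by_cases hkl : l = k
      · subst hkl
        rw [if_pos rfl, if_pos (by omega), ← neg_smul]
        congr 1; ring
      · rw [if_neg hkl, if_neg (by omega), neg_zero]
    · rw [if_neg (by omega)]
      simp only [h_neg, mul_left_comm, sub_self]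

/-- The source of submultiplicativity: creation operators permute monomials injectively, and
annihilation operators bring in integer factors only, whose p-adic absolute value is at most 1. -/
theorem supNorm_h_le (n : ℤ) (b : HeisenbergFock p) : supNorm (h n b) ≤ supNorm b := by
  obtain rfl | ⟨k, rfl⟩ | ⟨k, rfl⟩ := int_trichotomy n
  · rw [h_zero, supNorm_zero]
    exact supNorm_nonneg b
  · rw [h_succ]
    refine (supNorm_zsmul_le _ _).trans ((supNorm_le_iff _ (supNorm_nonneg b)).2 fun I => ?_)
    rw [MvPolynomial.coeff_pderiv, norm_mul]
    refine (mul_le_of_le_one_right (norm_nonneg _) ?_).trans (norm_coeff_le b _)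
    exact_mod_cast Padic.norm_int_le_one (p := p) ((I k : ℤ) + 1)
  · rw [h_neg]
    refine (supNorm_mul_le _ _).trans (mul_le_of_le_one_left (supNorm_nonneg b) ?_)
    refine (supNorm_le_iff _ zero_le_one).2 fun I => ?_
    classical
    rw [MvPolynomial.coeff_X]
    split_ifs <;> simp

/-- A polynomial involves finitely many variables. The bound carries + 2 since h_{k+1}
differentiates in `X k`. -/
theorem exists_h_eq_zero (b : HeisenbergFock p) : ∃ N : ℕ, ∀ i : ℤ, N ≤ i → h i b = 0 := by
  refine ⟨b.vars.sup id + 2, fun i hi => ?_⟩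
  obtain ⟨k, rfl⟩ : ∃ k : ℕ, i = k + 1 := ⟨(i - 1).toNat, by omega⟩
  rw [h_succ, MvPolynomial.pderiv_eq_zero_of_notMem_vars, smul_zero]
  intro hk
  have : k ≤ b.vars.sup id := Finset.le_sup (f := id) hk
  omega

/-- The modes of the divided derivative `(1/j!) ∂_z^j h(z)` as linear maps. -/
noncomputable def divDerivLin (j : ℕ) (s : ℤ) : HeisenbergFock p →ₗ[ℚ_[p]] HeisenbergFock p :=
  ((-1 : ℤ) ^ j * Ring.choose s j) • hLin (s - j)

theorem divDeriv_eq (j : ℕ) (s : ℤ) : divDeriv j h s = (divDerivLin j s : HeisenbergFock p → _) :=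
  rfl

theorem divDerivLin_apply (j : ℕ) (s : ℤ) (b : HeisenbergFock p) :
    divDerivLin j s b = ((-1 : ℤ) ^ j * Ring.choose s j) • h (s - j) b := rfl

theorem supNorm_divDerivLin_le (j : ℕ) (s : ℤ) (b : HeisenbergFock p) :
    supNorm (divDerivLin j s b) ≤ supNorm b :=
  (supNorm_zsmul_le _ _).trans (supNorm_h_le _ _)

theorem exists_divDerivLin_eq_zero (j : ℕ) (b : HeisenbergFock p) :
    ∃ N : ℕ, ∀ i : ℕ, N ≤ i → divDerivLin j i b = 0 := by
  obtain ⟨N, hN⟩ := exists_h_eq_zero b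
  exact ⟨N + j, fun i hi => by rw [divDerivLin_apply, hN _ (by omega), smul_zero]⟩

theorem h_divDerivLin (m : ℤ) (j : ℕ) (s : ℤ) (b : HeisenbergFock p) :
    h m (divDerivLin j s b) - divDerivLin j s (h m b)
      = if s = j - m then ((-1) ^ j * Ring.choose (j - m) j * m) • b else 0 := by
  rw [divDerivLin_apply, divDerivLin_apply, ← hLin_apply m (_ • _), map_zsmul, ← smul_sub,
    hLin_apply, h_commutator]
  by_cases hs : s = j - m
  · subst hs
    rw [if_pos (by omega), if_pos rfl, smul_smul]
  · rw [if_neg (by omega), if_neg hs, smul_zero]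

theorem divDerivLin_comm_of_neg (j k i l : ℕ) (b : HeisenbergFock p) :
    divDerivLin j (-1 - i) (divDerivLin k (-1 - l) b)
      = divDerivLin k (-1 - l) (divDerivLin j (-1 - i) b) := by
  simp only [divDerivLin_apply, ← hLin_apply, map_zsmul]
  rw [smul_comm]
  congr 2
  rw [← sub_eq_zero, hLin_apply, hLin_apply, hLin_apply, hLin_apply, h_commutator, if_neg (by omega)]

/-- Since (i choose j) = 0 for i < j, only operators h_n with n ≥ 0 occur. A central term would need
both indices to be 0, and it then carries the factor 0. -/
theorem divDerivLin_comm_of_nonneg (j k i l : ℕ) (b : HeisenbergFock p) :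
    divDerivLin j i (divDerivLin k l b) = divDerivLin k l (divDerivLin j i b) := by
  have h0 : ∀ {i j : ℕ}, i < j → Ring.choose (i : ℤ) j = 0 := fun {i j} h => by
    rw [Ring.choose_natCast, Nat.choose_eq_zero_of_lt h, Nat.cast_zero]
  simp only [divDerivLin_apply, ← hLin_apply, map_zsmul]
  rcases lt_or_ge i j with hij | hij
  · rw [h0 hij]; simp
  rcases lt_or_ge l k with hlk | hlk
  · rw [h0 hlk]; simp
  rw [smul_comm]
  congr 2
  rw [← sub_eq_zero, hLin_apply, hLin_apply, hLin_apply, hLin_apply, h_commutator]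
  split_ifs with h
  · rw [show (i : ℤ) - j = 0 by omega, zero_smul]
  · rfl

/-! ### Formal fields on the Fock space -/

/-- Sequences of linear maps that form a field and do not increase the sup-norm. -/
structure IsFormalField (B : ℤ → HeisenbergFock p → HeisenbergFock p) : Prop where
  isLinearMap : ∀ n, IsLinearMap ℚ_[p] (B n)
  exists_eq_zero : ∀ b, ∃ N : ℤ, ∀ n, N ≤ n → B n b = 0
  supNorm_le : ∀ n b, supNorm (B n b) ≤ supNorm b

namespace IsFormalField

variable {B : ℤ → HeisenbergFock p → HeisenbergFock p}

theorem map_zero (hB : IsFormalField B) (n : ℤ) : B n 0 = 0 := (hB.isLinearMap n).map_zero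

theorem map_add (hB : IsFormalField B) (n : ℤ) (x y : HeisenbergFock p) :
    B n (x + y) = B n x + B n y := (hB.isLinearMap n).map_add x y

theorem map_smul (hB : IsFormalField B) (n : ℤ) (c : ℚ_[p]) (x : HeisenbergFock p) :
    B n (c • x) = c • B n x := (hB.isLinearMap n).map_smul c x

/-- The products with a derivative of `h(z)` are finite sums, with arbitrarily long range. -/
theorem normalOrdered_eq (hB : IsFormalField B) {j : ℕ} {s : ℤ} {b : HeisenbergFock p} {M : ℕ}
    (h1 : ∀ k : ℕ, M ≤ k → B (s + k) b = 0) (h2 : ∀ k : ℕ, M ≤ k → divDerivLin j k b = 0) :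
    normalOrdered (divDeriv j h) B s b = ∑ k ∈ Finset.range M, divDerivLin j (-1 - k) (B (s + k) b)
      + ∑ k ∈ Finset.range M, B (s - 1 - k) (divDerivLin j k b) := by
  simp only [normalOrdered, divDeriv_eq]
  rw [finsum_eq_sum_range (N := M) fun i hi => by rw [h1 i hi, _root_.map_zero],
    finsum_eq_sum_range (N := M) fun i hi => by rw [h2 i hi, hB.map_zero]]

theorem exists_normalOrdered_eq (hB : IsFormalField B) (j : ℕ) (s : ℤ) (b : HeisenbergFock p) :
    ∃ N : ℕ, ∀ M : ℕ, N ≤ M → normalOrdered (divDeriv j h) B s b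
      = ∑ k ∈ Finset.range M, divDerivLin j (-1 - k) (B (s + k) b)
        + ∑ k ∈ Finset.range M, B (s - 1 - k) (divDerivLin j k b) := by
  obtain ⟨N1, hN1⟩ := hB.exists_eq_zero b
  obtain ⟨N2, hN2⟩ := exists_divDerivLin_eq_zero j b
  refine ⟨(N1 - s).toNat + N2, fun M hM => hB.normalOrdered_eq ?_ ?_⟩
  · exact fun k hk => hN1 _ (by omega)
  · exact fun k hk => hN2 _ (by omega)

/-- A common bound for finitely many vectors. -/
theorem exists_forall_lt_eq_zero (hB : IsFormalField B) (b : ℕ → HeisenbergFock p) (M : ℕ) :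
    ∃ N : ℤ, ∀ k < M, ∀ n, N ≤ n → B n (b k) = 0 := by
  choose N hN using fun k => hB.exists_eq_zero (b k)
  obtain ⟨N', hN'⟩ := ((Set.finite_Iio M).image N).bddAbove
  exact ⟨N', fun k hk n hn => hN k n ((hN' (Set.mem_image_of_mem N hk)).trans hn)⟩

theorem normalOrdered (hB : IsFormalField B) (j : ℕ) :
    IsFormalField (normalOrdered (divDeriv j h) B) where
  isLinearMap s := by
    refine ⟨fun x y => ?_, fun c x => ?_⟩
    · obtain ⟨N1, h1⟩ := hB.exists_normalOrdered_eq j s x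
      obtain ⟨N2, h2⟩ := hB.exists_normalOrdered_eq j s y
      obtain ⟨N3, h3⟩ := hB.exists_normalOrdered_eq j s (x + y)
      rw [h1 (N1 + N2 + N3) (by omega), h2 (N1 + N2 + N3) (by omega), h3 (N1 + N2 + N3) (by omega)]
      simp only [_root_.map_add, hB.map_add, Finset.sum_add_distrib]
      abel
    · obtain ⟨N1, h1⟩ := hB.exists_normalOrdered_eq j s x
      obtain ⟨N2, h2⟩ := hB.exists_normalOrdered_eq j s (c • x)
      rw [h1 (N1 + N2) (by omega), h2 (N1 + N2) (by omega)]
      simp only [_root_.map_smul, hB.map_smul, smul_add, Finset.smul_sum]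
  exists_eq_zero b := by
    obtain ⟨N1, h1⟩ := hB.exists_eq_zero b
    obtain ⟨N2, h2⟩ := exists_divDerivLin_eq_zero j b
    obtain ⟨N3, h3⟩ := hB.exists_forall_lt_eq_zero (fun k => divDerivLin j k b) N2
    -- The second sum has k < N2 only, so its index n - 1 - k stays above N3.
    refine ⟨max N1 (N3 + 1 + N2), fun n hn => ?_⟩
    rw [hB.normalOrdered_eq (M := N2) (fun k _ => h1 _ (by omega)) h2,
      Finset.sum_eq_zero fun k _ => by rw [h1 _ (by omega), _root_.map_zero],
      Finset.sum_eq_zero fun k hk => h3 k (Finset.mem_range.1 hk) _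
        (by have := Finset.mem_range.1 hk; omega), add_zero]
  supNorm_le s b := by
    obtain ⟨N, hN⟩ := hB.exists_normalOrdered_eq j s b
    rw [hN N le_rfl]
    refine (supNorm_add_le_max _ _).trans (max_le ?_ ?_)
    · exact supNorm_sum_le _ _ (supNorm_nonneg b) fun k _ =>
        (supNorm_divDerivLin_le _ _ _).trans (hB.supNorm_le _ _)
    · exact supNorm_sum_le _ _ (supNorm_nonneg b) fun k _ =>
        (hB.supNorm_le _ _).trans (supNorm_divDerivLin_le _ _ _)

/-- The four double sums record whether each of the two factors contributes a creation mode, placed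
to the left of `B`, or an annihilation mode, placed to its right. A common square range makes the
symmetry in `j` and `k` visible. -/
theorem normalOrdered_normalOrdered (hB : IsFormalField B) (j k : ℕ) (s : ℤ)
    (b : HeisenbergFock p) : ∃ N : ℕ, ∀ M : ℕ, N ≤ M →
    HeisenbergFock.normalOrdered (divDeriv j h) (HeisenbergFock.normalOrdered (divDeriv k h) B) s b
      = ((∑ i ∈ Finset.range M, ∑ l ∈ Finset.range M,
            divDerivLin j (-1 - i) (divDerivLin k (-1 - l) (B (s + i + l) b)))
          + ∑ i ∈ Finset.range M, ∑ l ∈ Finset.range M,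
            divDerivLin j (-1 - i) (B (s + i - 1 - l) (divDerivLin k l b)))
        + ((∑ i ∈ Finset.range M, ∑ l ∈ Finset.range M,
            divDerivLin k (-1 - l) (B (s + l - 1 - i) (divDerivLin j i b)))
          + ∑ i ∈ Finset.range M, ∑ l ∈ Finset.range M,
            B (s - 1 - i - 1 - l) (divDerivLin k l (divDerivLin j i b))) := by
  obtain ⟨N1, h1⟩ := hB.exists_eq_zero b
  obtain ⟨N2, h2⟩ := exists_divDerivLin_eq_zero j b
  obtain ⟨N3, h3⟩ := exists_divDerivLin_eq_zero k b
  obtain ⟨N4, h4⟩ := hB.exists_forall_lt_eq_zero (fun l => divDerivLin k l b) N3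
  obtain ⟨N5, h5⟩ := hB.exists_forall_lt_eq_zero (fun i => divDerivLin j i b) N2
  refine ⟨N2 + N3 + (N1 - s).toNat + (N4 + N3 + 1 - s).toNat + (N5 + N2 + 1 - s).toNat,
    fun M hM => ?_⟩
  have e1 : ∀ i : ℕ, HeisenbergFock.normalOrdered (divDeriv k h) B (s + i) b
      = ∑ l ∈ Finset.range M, divDerivLin k (-1 - l) (B (s + i + l) b)
        + ∑ l ∈ Finset.range M, B (s + i - 1 - l) (divDerivLin k l b) := fun i =>
    hB.normalOrdered_eq (fun l hl => h1 _ (by omega)) (fun l hl => h3 _ (by omega))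
  have e2 : ∀ i : ℕ, HeisenbergFock.normalOrdered (divDeriv k h) B (s - 1 - i) (divDerivLin j i b)
      = ∑ l ∈ Finset.range M, divDerivLin k (-1 - l) (B (s + l - 1 - i) (divDerivLin j i b))
        + ∑ l ∈ Finset.range M, B (s - 1 - i - 1 - l) (divDerivLin k l (divDerivLin j i b)) := by
    intro i
    simp only [show ∀ l : ℕ, s + (l : ℤ) - 1 - i = s - 1 - i + l from fun l => by ring]
    refine hB.normalOrdered_eq (fun l hl => ?_) (fun l hl => ?_)
    · rcases lt_or_ge i N2 with hi | hi
      · exact h5 i hi _ (by omega)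
      · rw [h2 i hi, hB.map_zero]
    · rw [divDerivLin_comm_of_nonneg, h3 _ (by omega), _root_.map_zero]
  rw [(hB.normalOrdered k).normalOrdered_eq (M := M) ?_ (fun i hi => h2 i (by omega))]
  · simp only [e1, e2, _root_.map_add, _root_.map_sum, Finset.sum_add_distrib]
  · intro i hi
    rw [e1, Finset.sum_eq_zero fun l _ => by rw [h1 _ (by omega), _root_.map_zero],
      Finset.sum_eq_zero fun l _ => ?_, add_zero]
    rcases lt_or_ge l N3 with hl | hl
    · exact h4 l hl _ (by omega)
    · rw [h3 l hl, hB.map_zero]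

/-- Exchanging `j` and `k` swaps the two mixed sums and preserves the two pure ones, as creation
modes commute among themselves and so do annihilation modes. -/
theorem normalOrdered_left_comm (hB : IsFormalField B) (j k : ℕ) :
    HeisenbergFock.normalOrdered (divDeriv j h) (HeisenbergFock.normalOrdered (divDeriv k h) B)
      = HeisenbergFock.normalOrdered (divDeriv k h)
        (HeisenbergFock.normalOrdered (divDeriv j h) B) := by
  funext s b
  obtain ⟨N1, h1⟩ := hB.normalOrdered_normalOrdered j k s b
  obtain ⟨N2, h2⟩ := hB.normalOrdered_normalOrdered k j s b
  rw [h1 (N1 + N2) (by omega), h2 (N1 + N2) (by omega)]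
  have e1 : ∀ i l : ℕ, divDerivLin j (-1 - i) (divDerivLin k (-1 - l) (B (s + i + l) b))
      = divDerivLin k (-1 - l) (divDerivLin j (-1 - i) (B (s + l + i) b)) := fun i l => by
    rw [divDerivLin_comm_of_neg, add_right_comm]
  have e2 : ∀ i l : ℕ, B (s - 1 - i - 1 - l) (divDerivLin k l (divDerivLin j i b))
      = B (s - 1 - l - 1 - i) (divDerivLin j i (divDerivLin k l b)) := fun i l => by
    rw [divDerivLin_comm_of_nonneg, show s - 1 - i - 1 - (l : ℤ) = s - 1 - l - 1 - i by ring]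
  simp only [e1, e2]
  rw [Finset.sum_comm, Finset.sum_comm (f := fun i l => B _ _),
    Finset.sum_comm (f := fun i l : ℕ => divDerivLin j (-1 - i) (B (s + i - 1 - l) _)),
    Finset.sum_comm (f := fun i l : ℕ => divDerivLin k (-1 - l) (B (s + l - 1 - i) _))]
  abel

end IsFormalField

theorem isFormalField_idField : IsFormalField (idField : ℤ → HeisenbergFock p → _) where
  isLinearMap n := by
    refine ⟨fun x y => ?_, fun c x => ?_⟩ <;> simp only [idField] <;> split_ifs <;> simp
  exists_eq_zero b := ⟨0, fun n hn => if_neg (by omega)⟩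
  supNorm_le n b := by
    simp only [idField]
    split_ifs
    · exact le_rfl
    · rw [supNorm_zero]
      exact supNorm_nonneg b

/-- The normally ordered product with a derivative of `h(z)` as an operation on formal fields. -/
noncomputable def normalOrderedOp (j : ℕ) (B : {B : ℤ → HeisenbergFock p → HeisenbergFock p // IsFormalField B}) :
    {B : ℤ → HeisenbergFock p → HeisenbergFock p // IsFormalField B} :=
  ⟨normalOrdered (divDeriv j h) B.1, B.2.normalOrdered j⟩

instance : LeftCommutative (normalOrderedOp (p := p)) :=
  ⟨fun j k B => Subtype.ext (B.2.normalOrdered_left_comm j k)⟩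

theorem coe_foldr_normalOrderedOp (l : List ℕ) :
    (l.foldr normalOrderedOp ⟨idField, isFormalField_idField⟩ :
      {B : ℤ → HeisenbergFock p → HeisenbergFock p // IsFormalField B}).1
      = l.foldr (fun j B => normalOrdered (divDeriv j h) B) idField := by
  induction l with
  | nil => rfl
  | cons j l ih => rw [List.foldr_cons, List.foldr_cons, ← ih]; rfl

theorem isFormalField_monomialField (I : ℕ →₀ ℕ) :
    IsFormalField (monomialField I : ℤ → HeisenbergFock p → _) := by
  rw [monomialField, ← coe_foldr_normalOrderedOp]
  exact Subtype.property _

theorem monomialField_zero : monomialField 0 = (idField : ℤ → HeisenbergFock p → _) := by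
  simp [monomialField]

/-- A new factor may land anywhere in the sorted list; left-commutativity allows it to be moved to
the front. -/
theorem monomialField_single_add (j : ℕ) (I : ℕ →₀ ℕ) :
    monomialField (Finsupp.single j 1 + I)
      = normalOrdered (divDeriv j h) (monomialField I : ℤ → HeisenbergFock p → _) := by
  have hperm : ((Finsupp.toMultiset (Finsupp.single j 1 + I)).sort).Perm
      (j :: (Finsupp.toMultiset I).sort) := by
    rw [← Multiset.coe_eq_coe, Multiset.sort_eq, ← Multiset.cons_coe, Multiset.sort_eq, map_add,
      Finsupp.toMultiset_single, one_smul, Multiset.singleton_add]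
  rw [monomialField, monomialField, ← coe_foldr_normalOrderedOp, ← coe_foldr_normalOrderedOp,
    hperm.foldr_eq, List.foldr_cons]
  rfl

/-! ### The products as bilinear maps -/

theorem modeProduct_eq_sum_of_subset {a : HeisenbergFock p} {s : Finset (ℕ →₀ ℕ)}
    (hs : a.support ⊆ s) (n : ℤ) (b : HeisenbergFock p) :
    a.modeProduct n b = ∑ I ∈ s, a.coeff I • monomialField I n b :=
  Finset.sum_subset hs fun I _ hI => by rw [MvPolynomial.notMem_support_iff.1 hI, zero_smul]

theorem modeProduct_add_left (a a' : HeisenbergFock p) (n : ℤ) (b : HeisenbergFock p) :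
    (a + a').modeProduct n b = a.modeProduct n b + a'.modeProduct n b := by
  classical
  rw [modeProduct_eq_sum_of_subset (MvPolynomial.support_add (p := a) (q := a')),
    modeProduct_eq_sum_of_subset (a := a) Finset.subset_union_left,
    modeProduct_eq_sum_of_subset (a := a') Finset.subset_union_right, ← Finset.sum_add_distrib]
  exact Finset.sum_congr rfl fun I _ => by rw [MvPolynomial.coeff_add, add_smul]

theorem modeProduct_smul_left (c : ℚ_[p]) (a : HeisenbergFock p) (n : ℤ) (b : HeisenbergFock p) :
    (c • a).modeProduct n b = c • a.modeProduct n b := by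
  rw [modeProduct_eq_sum_of_subset (MvPolynomial.support_smul (a := c) (f := a)),
    modeProduct, Finset.smul_sum]
  exact Finset.sum_congr rfl fun I _ => by rw [MvPolynomial.coeff_smul, smul_assoc]

/-- The `n`-th product as a bilinear map. -/
noncomputable def mode (n : ℤ) : HeisenbergFock p →ₗ[ℚ_[p]] HeisenbergFock p →ₗ[ℚ_[p]] HeisenbergFock p :=
  LinearMap.mk₂ ℚ_[p] (fun a b => a.modeProduct n b)
    (fun a a' b => modeProduct_add_left a a' n b)
    (fun c a b => modeProduct_smul_left c a n b)
    (fun a b b' => by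
      simp only [modeProduct, ((isFormalField_monomialField _).map_add n b b'), smul_add,
        Finset.sum_add_distrib])
    (fun c a b => by
      simp only [modeProduct, ((isFormalField_monomialField _).map_smul n c b), Finset.smul_sum,
        smul_comm c])

theorem mode_apply (n : ℤ) (a b : HeisenbergFock p) : mode n a b = a.modeProduct n b := rfl

theorem mode_monomial (n : ℤ) (I : ℕ →₀ ℕ) (c : ℚ_[p]) (b : HeisenbergFock p) :
    mode n (MvPolynomial.monomial I c) b = c • monomialField I n b := by
  rw [mode_apply, modeProduct_eq_sum_of_subset MvPolynomial.support_monomial_subset,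
    Finset.sum_singleton, MvPolynomial.coeff_monomial, if_pos rfl]

theorem supNorm_mode_le (n : ℤ) (a b : HeisenbergFock p) :
    supNorm (mode n a b) ≤ supNorm a * supNorm b := by
  refine supNorm_sum_le _ _ (mul_nonneg (supNorm_nonneg a) (supNorm_nonneg b)) fun I _ => ?_
  refine (supNorm_smul_le _ _).trans ?_
  exact mul_le_mul (norm_coeff_le a I) ((isFormalField_monomialField I).supNorm_le n b)
    (supNorm_nonneg _) (supNorm_nonneg a)

theorem exists_mode_eq_zero (a b : HeisenbergFock p) :
    ∃ N : ℤ, ∀ n, N ≤ n → mode n a b = 0 := by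
  induction a using MvPolynomial.induction_on' with
  | monomial I c =>
    obtain ⟨N, hN⟩ := (isFormalField_monomialField I).exists_eq_zero b
    exact ⟨N, fun n hn => by rw [mode_monomial, hN n hn, smul_zero]⟩
  | add a a' ha ha' =>
    obtain ⟨N, hN⟩ := ha
    obtain ⟨N', hN'⟩ := ha'
    exact ⟨max N N', fun n hn => by
      rw [map_add, LinearMap.add_apply, hN n (le_of_max_le_left hn), hN' n (le_of_max_le_right hn),
        add_zero]⟩

theorem mode_one (n : ℤ) (b : HeisenbergFock p) : mode n 1 b = if n = -1 then b else 0 := by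
  rw [← MvPolynomial.C_1, ← MvPolynomial.monomial_zero', mode_monomial, one_smul,
    monomialField_zero]
  rfl

/-- The recursion behind every induction on the first argument. It holds for all large ranges, so
that several instances can be brought to one common range. -/
theorem exists_mode_X_mul_eq (j : ℕ) (a : HeisenbergFock p) (n : ℤ) (b : HeisenbergFock p) :
    ∃ N : ℕ, ∀ M : ℕ, N ≤ M → mode n (MvPolynomial.X j * a) b
      = ∑ i ∈ Finset.range M, divDerivLin j (-1 - i) (mode (n + i) a b)
        + ∑ i ∈ Finset.range M, mode (n - 1 - i) a (divDerivLin j i b) := by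
  induction a using MvPolynomial.induction_on' with
  | monomial I c =>
    obtain ⟨N, hN⟩ := (isFormalField_monomialField I).exists_normalOrdered_eq j n b
    refine ⟨N, fun M hM => ?_⟩
    rw [MvPolynomial.X, MvPolynomial.monomial_mul, one_mul, mode_monomial, monomialField_single_add,
      hN M hM]
    simp only [mode_monomial, map_smul, smul_add, Finset.smul_sum]
  | add a a' ha ha' =>
    obtain ⟨N, hN⟩ := ha
    obtain ⟨N', hN'⟩ := ha'
    refine ⟨max N N', fun M hM => ?_⟩
    rw [mul_add, map_add, LinearMap.add_apply, hN M (le_of_max_le_left hM),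
      hN' M (le_of_max_le_right hM)]
    simp only [map_add, LinearMap.add_apply, Finset.sum_add_distrib]
    abel

/-! ### Commutators of h_m with vertex operators -/

theorem h_X_mul (m : ℤ) (k : ℕ) (b : HeisenbergFock p) :
    h m (MvPolynomial.X k * b)
      = MvPolynomial.X k * h m b + if m = k + 1 then m • b else 0 := by
  rw [← sub_eq_iff_eq_add', ← h_neg, ← h_neg, h_commutator]
  exact if_congr (by omega) rfl rfl

theorem h_one {m : ℤ} (hm : 0 ≤ m) : h m (1 : HeisenbergFock p) = 0 := by
  obtain rfl | ⟨k, rfl⟩ | ⟨k, rfl⟩ := int_trichotomy m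
  · rfl
  · rw [h_succ, MvPolynomial.pderiv_one, smul_zero]
  · omega

theorem h_map_zero (m : ℤ) : h m (0 : HeisenbergFock p) = 0 := (hLin m).map_zero

theorem h_map_add (m : ℤ) (a b : HeisenbergFock p) : h m (a + b) = h m a + h m b :=
  (hLin m).map_add a b

theorem h_map_zsmul (m n : ℤ) (a : HeisenbergFock p) : h m (n • a) = n • h m a :=
  map_zsmul (hLin m) n a

theorem h_map_smul (m : ℤ) (c : ℚ_[p]) (a : HeisenbergFock p) : h m (c • a) = c • h m a :=
  (hLin m).map_smul c a

theorem hasFiniteSupport_h (a : HeisenbergFock p) {M : Type*} [AddCommGroup M]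
    (φ : ℕ → HeisenbergFock p →+ M) : (fun j : ℕ => φ j (h j a)).HasFiniteSupport := by
  obtain ⟨N, hN⟩ := exists_h_eq_zero a
  exact hasFiniteSupport_of_forall_le (N := N) fun i hi => by
    rw [hN _ (by exact_mod_cast hi), map_zero]

/-- Induction along the annihilation operators `h_j`, `j ≥ 0`. -/
theorem annihilation_induction {P : HeisenbergFock p → Prop} (zero : P 0)
    (step : ∀ u, (∀ j : ℕ, P (h j u)) → P u) (u : HeisenbergFock p) : P u := by
  -- `A d u` says that every word of length `d` in the operators h_j, j ≥ 0, kills `u`.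
  let A : ℕ → HeisenbergFock p → Prop := fun d =>
    Nat.rec (fun u => u = 0) (fun _ A u => ∀ j : ℕ, A (h j u)) d
  have A_succ : ∀ d u, A (d + 1) u ↔ ∀ j : ℕ, A d (h j u) := fun _ _ => Iff.rfl
  have A_zero : ∀ d, A d 0 := by
    intro d
    induction d with
    | zero => rfl
    | succ d ih => exact fun j => by rw [h_map_zero]; exact ih
  have A_add : ∀ d u v, A d u → A d v → A d (u + v) := by
    intro d
    induction d with
    | zero => intro u v hu hv; change u + v = 0; rw [show u = 0 from hu, show v = 0 from hv, add_zero]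
    | succ d ih => exact fun u v hu hv j => by rw [h_map_add]; exact ih _ _ (hu j) (hv j)
  have A_zsmul : ∀ d (n : ℤ) u, A d u → A d (n • u) := by
    intro d n
    induction d with
    | zero => intro u hu; change n • u = 0; rw [show u = 0 from hu, smul_zero]
    | succ d ih => exact fun u hu j => by rw [h_map_zsmul]; exact ih _ (hu j)
  have A_mono : ∀ d e u, A d u → A (d + e) u := by
    intro d
    induction d with
    | zero => intro e u hu; rw [show u = 0 from hu]; exact A_zero _
    | succ d ih => intro e u hu; rw [add_right_comm]; exact fun j => ih e _ (hu j)
  -- Moving h_j past `X k` costs at most a multiple of `u`, so one extra letter suffices. Hence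
  -- every polynomial satisfies some `A d`.
  have A_X : ∀ d k u, A d u → A (d + 1) (MvPolynomial.X k * u) := by
    intro d k
    induction d with
    | zero =>
      intro u hu j
      rw [show u = 0 from hu, mul_zero, h_map_zero]
    | succ d ih =>
      intro u hu j
      rw [h_X_mul]
      refine A_add (d + 1) _ _ (ih _ (hu j)) ?_
      split_ifs
      · exact A_zsmul (d + 1) _ _ hu
      · exact A_zero (d + 1)
  have hA : ∃ d, A d u := by
    induction u using MvPolynomial.induction_on with
    | C c =>
      refine ⟨1, fun j => ?_⟩
      rw [← mul_one (MvPolynomial.C c), ← MvPolynomial.smul_eq_C_mul, h_map_smul,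
        h_one (by omega), smul_zero]
    | add u v hu hv =>
      obtain ⟨d, hd⟩ := hu
      obtain ⟨e, he⟩ := hv
      exact ⟨d + e, A_add _ _ _ (A_mono _ _ _ hd) (by rw [add_comm]; exact A_mono _ _ _ he)⟩
    | mul_X u k hu =>
      obtain ⟨d, hd⟩ := hu
      exact ⟨d + 1, by rw [mul_comm]; exact A_X _ _ _ hd⟩
  obtain ⟨d, hd⟩ := hA
  induction d generalizing u with
  | zero => rw [show u = 0 from hd]; exact zero
  | succ d ih => exact step u fun j => ih _ (hd j)

theorem exists_mode_X_mul_eq_of_lt (j : ℕ) (a : ℕ → HeisenbergFock p) (n : ℕ → ℤ)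
    (b : HeisenbergFock p) (J : ℕ) : ∃ N : ℕ, ∀ M : ℕ, N ≤ M → ∀ l < J,
    mode (n l) (MvPolynomial.X j * a l) b
      = ∑ i ∈ Finset.range M, divDerivLin j (-1 - i) (mode (n l + i) (a l) b)
        + ∑ i ∈ Finset.range M, mode (n l - 1 - i) (a l) (divDerivLin j i b) := by
  choose N hN using fun l => exists_mode_X_mul_eq j (a l) (n l) b
  obtain ⟨N', hN'⟩ := ((Set.finite_Iio J).image N).bddAbove
  exact ⟨N', fun M hM l hl => hN l M ((hN' (Set.mem_image_of_mem N hl)).trans hM)⟩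

/-- Upper negation. It turns the central coefficient of `h_divDerivLin` into (m - 1 choose k). -/
theorem choose_sub_eq (m : ℤ) (k : ℕ) :
    (-1) ^ k * Ring.choose ((k : ℤ) - m) k = Ring.choose (m - 1) k := by
  rw [← neg_sub m, Ring.choose_neg, Units.smul_def, smul_eq_mul, sub_add_cancel, ← mul_assoc,
    Int.negOnePow_def, zpow_natCast]
  push_cast
  rw [← mul_pow, neg_one_mul, neg_neg, one_pow, one_mul]

/-- The commutator of `h_m` with a vertex operator. -/
theorem h_mode (m n : ℤ) (a b : HeisenbergFock p) :
    h m (mode n a b) - mode n a (h m b)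
      = ∑ᶠ j : ℕ, Ring.choose m j • mode (m + n - j) (h j a) b := by
  have hsupp : ∀ (a b : HeisenbergFock p) (n : ℤ),
      (fun j : ℕ => Ring.choose m j • mode (m + n - j) (h j a) b).HasFiniteSupport := fun a b n =>
    hasFiniteSupport_h a fun j =>
      (zsmulAddGroupHom (Ring.choose m j)).comp ((mode (m + n - j)).flip b).toAddMonoidHom
  induction a using MvPolynomial.induction_on generalizing n b with
  | C c =>
    have h0 : ∀ j : ℕ, h j (MvPolynomial.C c : HeisenbergFock p) = 0 := fun j => by
      rw [← mul_one (MvPolynomial.C c), ← MvPolynomial.smul_eq_C_mul, h_map_smul,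
        h_one (by omega), smul_zero]
    simp only [h0, map_zero, LinearMap.zero_apply, smul_zero, finsum_zero]
    rw [← mul_one (MvPolynomial.C c), ← MvPolynomial.smul_eq_C_mul]
    simp only [map_smul, LinearMap.smul_apply, mode_one, h_map_smul]
    split_ifs <;> simp [h_map_zero]
  | add a a' ha ha' =>
    simp only [map_add, LinearMap.add_apply, h_map_add, smul_add]
    rw [finsum_add_distrib (hsupp _ _ _) (hsupp _ _ _), ← ha, ← ha']
    abel
  | mul_X a k ih =>
    rw [mul_comm a]
    obtain ⟨J, hJ⟩ := exists_h_eq_zero a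
    have hJ' : ∀ j : ℕ, J + (k + 2) ≤ j → h j (MvPolynomial.X k * a) = 0 := fun j hj => by
      rw [h_X_mul, hJ _ (by omega), mul_zero, if_neg (by omega), add_zero]
    have ih' : ∀ (n : ℤ) (b : HeisenbergFock p), h m (mode n a b) = mode n a (h m b)
        + ∑ j ∈ Finset.range (J + (k + 2)), Ring.choose m j • mode (m + n - j) (h j a) b := by
      intro n b
      rw [← sub_eq_iff_eq_add', ih, finsum_eq_sum_range fun i hi => ?_]
      rw [hJ _ (by omega), map_zero, LinearMap.zero_apply, smul_zero]
    rw [finsum_eq_sum_range (N := J + (k + 2)) fun j hj => by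
      rw [hJ' j hj, map_zero, LinearMap.zero_apply, smul_zero]]
    obtain ⟨N1, h1⟩ := exists_mode_X_mul_eq k a n b
    obtain ⟨N2, h2⟩ := exists_mode_X_mul_eq k a n (h m b)
    obtain ⟨N3, h3⟩ := exists_mode_X_mul_eq_of_lt k (fun j => h j a) (fun j => m + n - j) b
      (J + (k + 2))
    set M := N1 + N2 + N3 + (k - m).toNat + (m - k).toNat + 1 with hM
    have hD : ∀ (s : ℤ) (b : HeisenbergFock p), h m (divDerivLin k s b) = divDerivLin k s (h m b)
        + if s = k - m then ((-1) ^ k * Ring.choose (k - m) k * m) • b else 0 := fun s b => by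
      rw [← h_divDerivLin, add_sub_cancel]
    -- The central terms: the mode k - m of the derivative of h(z) is annihilating if m ≤ k and
    -- creating if m > k, so exactly one of the two sums contributes, and the result is the same.
    -- `M` is chosen large enough to contain that index.
    have hδ : ∑ i ∈ Finset.range M, (if -1 - (i : ℤ) = k - m then
          ((-1) ^ k * Ring.choose (k - m) k * m) • mode (n + i) a b else 0)
        + ∑ i ∈ Finset.range M, (if (i : ℤ) = k - m then
          ((-1) ^ k * Ring.choose (k - m) k * m) • mode (n - 1 - i) a b else 0)
        = ((-1) ^ k * Ring.choose (k - m) k * m) • mode (m + n - (k + 1)) a b := by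
      rcases lt_or_ge m (k + 1) with hmk | hmk
      · rw [Finset.sum_eq_zero fun i _ => if_neg (by omega), zero_add,
          Finset.sum_eq_single (k - m).toNat]
        · rw [if_pos (by omega), show n - 1 - ((k - m).toNat : ℤ) = m + n - (k + 1) by omega]
        · exact fun i _ hi => if_neg (by omega)
        · exact fun hi => absurd (Finset.mem_range.2 (by omega)) hi
      · rw [Finset.sum_eq_zero (s := Finset.range M)
          (f := fun i : ℕ => ite ((i : ℤ) = k - m) _ _) fun i _ => if_neg (by omega), add_zero,
          Finset.sum_eq_single (m - k - 1).toNat]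
        · rw [if_pos (by omega), show n + ((m - k - 1).toNat : ℤ) = m + n - (k + 1) by omega]
        · exact fun i _ hi => if_neg (by omega)
        · exact fun hi => absurd (Finset.mem_range.2 (by omega)) hi
    -- The matching term on the right comes from j = k + 1, where h_j hits the factor `X k`.
    have hδ' : ∑ j ∈ Finset.range (J + (k + 2)), Ring.choose m j
        • mode (m + n - j) (if (j : ℤ) = k + 1 then (j : ℤ) • a else 0) b
        = ((-1) ^ k * Ring.choose (k - m) k * m) • mode (m + n - (k + 1)) a b := by
      rw [Finset.sum_eq_single (k + 1)]
      · rw [if_pos (by push_cast; rfl), map_zsmul, LinearMap.smul_apply, smul_smul, choose_sub_eq,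
          mul_comm _ m, ← succ_mul_choose_succ, mul_comm]
        push_cast
        rfl
      · intro j _ hj
        rw [if_neg (by omega), map_zero, LinearMap.zero_apply, smul_zero]
      · exact fun hi => absurd (Finset.mem_range.2 (by omega)) hi
    simp only [h_X_mul, map_add, LinearMap.add_apply, smul_add, Finset.sum_add_distrib]
    have e1 : ∀ i : ℕ, h m (divDerivLin k (-1 - i) (mode (n + i) a b))
        = divDerivLin k (-1 - i) (mode (n + i) a (h m b))
          + (∑ j ∈ Finset.range (J + (k + 2)), Ring.choose m j
            • divDerivLin k (-1 - i) (mode (m + n - j + i) (h j a) b))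
          + if -1 - (i : ℤ) = k - m then
          ((-1) ^ k * Ring.choose (k - m) k * m) • mode (n + i) a b else 0 := fun i => by
      rw [hD, ih', map_add, map_sum]
      simp only [map_zsmul, ← add_assoc, add_sub_right_comm]
    have e2 : ∀ i : ℕ, h m (mode (n - 1 - i) a (divDerivLin k i b))
        = mode (n - 1 - i) a (divDerivLin k i (h m b))
          + (∑ j ∈ Finset.range (J + (k + 2)), Ring.choose m j
            • mode (m + n - j - 1 - i) (h j a) (divDerivLin k i b))
          + if (i : ℤ) = k - m then
          ((-1) ^ k * Ring.choose (k - m) k * m) • mode (n - 1 - i) a b else 0 := fun i => by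
      rw [ih', hD, map_add, add_right_comm]
      congr 1
      · congr 1
        refine Finset.sum_congr rfl fun j _ => ?_
        rw [show m + (n - 1 - i) - (j : ℤ) = m + n - j - 1 - i by ring]
      · split_ifs
        · rw [map_zsmul]
        · rw [map_zero]
    have e3 : ∑ j ∈ Finset.range (J + (k + 2)), Ring.choose m j
          • mode (m + n - j) (MvPolynomial.X k * h j a) b
        = (∑ i ∈ Finset.range M, ∑ j ∈ Finset.range (J + (k + 2)), Ring.choose m j
            • divDerivLin k (-1 - i) (mode (m + n - j + i) (h j a) b))
          + ∑ i ∈ Finset.range M, ∑ j ∈ Finset.range (J + (k + 2)), Ring.choose m j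
            • mode (m + n - j - 1 - i) (h j a) (divDerivLin k i b) := by
      rw [Finset.sum_comm, Finset.sum_comm (s := Finset.range M), ← Finset.sum_add_distrib]
      refine Finset.sum_congr rfl fun j hj => ?_
      rw [h3 M (by omega) j (Finset.mem_range.1 hj), smul_add, Finset.smul_sum, Finset.smul_sum]
    rw [hδ', ← hδ, e3, h1 M (by omega), h2 M (by omega), h_map_add,
      ← hLin_apply m (∑ i ∈ _, _), ← hLin_apply m (∑ i ∈ _, _), map_sum, map_sum]
    simp only [hLin_apply, e1, e2, Finset.sum_add_distrib]
    abel

/-! ### Schur's lemma for the Fock space -/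

/-- Characteristic zero: a coefficient at `I` with I_k > 0 reappears in the k-th derivative with the
nonzero factor I_k. -/
theorem eq_C_of_pderiv_eq_zero {a : HeisenbergFock p} (ha : ∀ k, MvPolynomial.pderiv k a = 0) :
    a = MvPolynomial.C (MvPolynomial.constantCoeff a) := by
  classical
  ext I
  rw [MvPolynomial.coeff_C]
  split_ifs with hI
  · rw [← hI, MvPolynomial.constantCoeff_eq]
  · obtain ⟨k, hk⟩ := Finsupp.ne_iff.1 (Ne.symm hI)
    have h := congrArg (MvPolynomial.coeff (I - Finsupp.single k 1)) (ha k)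
    have hle : Finsupp.single k 1 ≤ I := by
      rw [Finsupp.single_le_iff]
      exact Nat.one_le_iff_ne_zero.2 hk
    rw [MvPolynomial.coeff_pderiv, MvPolynomial.coeff_zero, tsub_add_cancel_of_le hle] at h
    exact (mul_eq_zero.1 h).resolve_right (Nat.cast_add_one_ne_zero _)

/-- A linear map that commutes with the Heisenberg algebra is a scalar. -/
theorem isLinearMap_eq_smul {X : HeisenbergFock p → HeisenbergFock p} (hX : IsLinearMap ℚ_[p] X)
    (hcomm : ∀ m b, h m (X b) = X (h m b)) (b : HeisenbergFock p) :
    X b = MvPolynomial.constantCoeff (X 1) • b := by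
  -- The annihilation operators kill 1, hence also `X 1`. The creation operators then carry the
  -- scalar from 1 to all of S.
  have h1 : X 1 = MvPolynomial.C (MvPolynomial.constantCoeff (X 1)) := by
    refine eq_C_of_pderiv_eq_zero fun k => ?_
    have h := hcomm (k + 1) 1
    rw [h_one (by omega), hX.map_zero, h_succ] at h
    exact (smul_eq_zero.1 h).resolve_left (by positivity)
  induction b using MvPolynomial.induction_on with
  | C c =>
    rw [← mul_one (MvPolynomial.C c), ← MvPolynomial.smul_eq_C_mul, hX.map_smul]
    conv_lhs => rw [h1]
    rw [MvPolynomial.smul_eq_C_mul, MvPolynomial.smul_eq_C_mul, MvPolynomial.smul_eq_C_mul]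
    ring
  | add a b ha hb => rw [hX.map_add, ha, hb, smul_add]
  | mul_X a k ha =>
    rw [mul_comm, ← h_neg, ← hcomm, ha, h_map_smul]

theorem isLinearMap_eq_zero {X : HeisenbergFock p → HeisenbergFock p} (hX : IsLinearMap ℚ_[p] X)
    (hcomm : ∀ m b, h m (X b) = X (h m b)) (h1 : MvPolynomial.constantCoeff (X 1) = 0)
    (b : HeisenbergFock p) : X b = 0 := by
  rw [isLinearMap_eq_smul hX hcomm, h1, zero_smul]

/-! ### Creation axioms and constant terms of products -/

theorem mode_X (n : ℤ) (j : ℕ) (b : HeisenbergFock p) :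
    mode n (MvPolynomial.X j) b = divDerivLin j n b := by
  rw [← mul_one (MvPolynomial.X j)]
  obtain ⟨N, hN⟩ := exists_mode_X_mul_eq j 1 n b
  rw [hN (N + n.natAbs + 1) (by omega)]
  simp only [mode_one]
  -- The identity field has a single mode, so one term survives: in the creation sum if n < 0, in
  -- the annihilation sum if n ≥ 0.
  rcases lt_or_ge n 0 with hn | hn
  · rw [Finset.sum_eq_single (-1 - n).toNat, Finset.sum_eq_zero, add_zero, if_pos (by omega),
      show -1 - ((-1 - n).toNat : ℤ) = n by omega]
    · exact fun i _ => if_neg (by omega)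
    · intro i _ hi
      rw [if_neg (by omega), map_zero]
    · exact fun hi => absurd (Finset.mem_range.2 (by omega)) hi
  · rw [Finset.sum_eq_zero, Finset.sum_eq_single n.toNat, zero_add, if_pos (by omega),
      show ((n.toNat : ℕ) : ℤ) = n by omega]
    · exact fun i _ hi => if_neg (by omega)
    · exact fun hi => absurd (Finset.mem_range.2 (by omega)) hi
    · intro i _
      rw [if_neg (by omega), map_zero]

theorem mode_X_zero (n : ℤ) (b : HeisenbergFock p) : mode n (MvPolynomial.X 0) b = h n b := by
  rw [mode_X, divDerivLin_apply, Ring.choose_zero_right, pow_zero, one_mul, one_smul,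
    Nat.cast_zero, sub_zero]

theorem divDerivLin_natCast_of_lt {j i : ℕ} (hij : i < j) (b : HeisenbergFock p) :
    divDerivLin j i b = 0 := by
  rw [divDerivLin_apply, Ring.choose_natCast, Nat.choose_eq_zero_of_lt hij, Nat.cast_zero, mul_zero,
    zero_smul]

theorem divDerivLin_natCast_one (j i : ℕ) : divDerivLin j i (1 : HeisenbergFock p) = 0 := by
  rcases lt_or_ge i j with hij | hij
  · exact divDerivLin_natCast_of_lt hij 1
  · rw [divDerivLin_apply, h_one (by omega), smul_zero]

theorem divDerivLin_neg (j i : ℕ) (b : HeisenbergFock p) : divDerivLin j (-1 - i) b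
    = ((-1) ^ j * Ring.choose (-1 - i : ℤ) j) • (MvPolynomial.X (i + j) * b) := by
  rw [divDerivLin_apply, ← h_neg]
  congr 2
  push_cast
  ring

theorem constantCoeff_divDerivLin_neg (j i : ℕ) (b : HeisenbergFock p) :
    MvPolynomial.constantCoeff (divDerivLin j (-1 - i) b) = 0 := by
  rw [divDerivLin_neg, map_zsmul, map_mul, MvPolynomial.constantCoeff_X, zero_mul, smul_zero]

/-- On the vacuum the annihilation half of the recursion disappears, and the other half uses only
modes of index at least `n`. -/
theorem mode_one_right_of_nonneg {n : ℤ} (hn : 0 ≤ n) (a : HeisenbergFock p) :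
    mode n a 1 = 0 := by
  induction a using MvPolynomial.induction_on generalizing n with
  | C c =>
    rw [← mul_one (MvPolynomial.C c), ← MvPolynomial.smul_eq_C_mul, map_smul, LinearMap.smul_apply,
      mode_one, if_neg (by omega), smul_zero]
  | add a b ha hb => rw [map_add, LinearMap.add_apply, ha hn, hb hn, add_zero]
  | mul_X a k ha =>
    obtain ⟨N, hN⟩ := exists_mode_X_mul_eq k a n 1
    rw [mul_comm, hN N le_rfl]
    simp only [divDerivLin_natCast_one, map_zero, Finset.sum_const_zero, add_zero]
    exact Finset.sum_eq_zero fun i _ => by rw [ha (by omega), map_zero]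

theorem mode_neg_one_one_right (a : HeisenbergFock p) : mode (-1) a 1 = a := by
  induction a using MvPolynomial.induction_on with
  | C c =>
    rw [← mul_one (MvPolynomial.C c), ← MvPolynomial.smul_eq_C_mul, map_smul, LinearMap.smul_apply,
      mode_one, if_pos rfl]
  | add a b ha hb => rw [map_add, LinearMap.add_apply, ha, hb]
  | mul_X a k ha =>
    obtain ⟨N, hN⟩ := exists_mode_X_mul_eq k a (-1) 1
    rw [mul_comm, hN (N + 1) (by omega)]
    simp only [divDerivLin_natCast_one, map_zero, Finset.sum_const_zero, add_zero]
    rw [Finset.sum_range_succ', Finset.sum_eq_zero, zero_add, Nat.cast_zero, add_zero, ha,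
      show (-1 - 0 : ℤ) = -1 - (0 : ℕ) by simp, divDerivLin_neg]
    · have hc : (-1) ^ k * Ring.choose (-1 - ((0 : ℕ) : ℤ)) k = 1 := by
        have := choose_sub_eq ((k : ℤ) + 1) k
        rw [add_sub_cancel_right, Ring.choose_natCast, Nat.choose_self] at this
        rw [show (-1 - ((0 : ℕ) : ℤ)) = k - (k + 1) by push_cast; ring, this, Nat.cast_one]
      rw [hc, one_smul, zero_add]
    · intro i _
      rw [mode_one_right_of_nonneg (by omega), map_zero]

/-- Creation modes multiply by a variable and so leave no constant term. -/
theorem constantCoeff_mode_one_right (n : ℤ) (a : HeisenbergFock p) :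
    MvPolynomial.constantCoeff (mode n a 1)
      = if n = -1 then MvPolynomial.constantCoeff a else 0 := by
  induction a using MvPolynomial.induction_on with
  | C c =>
    rw [← mul_one (MvPolynomial.C c), ← MvPolynomial.smul_eq_C_mul, map_smul, LinearMap.smul_apply,
      mode_one]
    split_ifs
    · rfl
    · rw [smul_zero, map_zero]
  | add a b ha hb =>
    rw [map_add, LinearMap.add_apply, map_add, ha, hb, map_add]
    split_ifs
    · rfl
    · rw [add_zero]
  | mul_X a k ha =>
    obtain ⟨N, hN⟩ := exists_mode_X_mul_eq k a n 1
    rw [mul_comm, hN N le_rfl]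
    simp only [divDerivLin_natCast_one, map_zero, Finset.sum_const_zero, add_zero, map_sum,
      constantCoeff_divDerivLin_neg, map_mul, MvPolynomial.constantCoeff_X, zero_mul, ite_self]

theorem constantCoeff_smul (c : ℚ_[p]) (a : HeisenbergFock p) :
    MvPolynomial.constantCoeff (c • a) = c * MvPolynomial.constantCoeff a := by
  rw [MvPolynomial.smul_eq_C_mul, map_mul, MvPolynomial.constantCoeff_C]

/-- The constant terms of the two products of `u` and `v` agree up to sign. -/
theorem constantCoeff_mode_comm (n : ℤ) (u v : HeisenbergFock p) :
    MvPolynomial.constantCoeff (mode n u v)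
      = ((n + 1).negOnePow : ℤ) • MvPolynomial.constantCoeff (mode n v u) := by
  induction u using MvPolynomial.induction_on generalizing n v with
  | C c =>
    rw [← mul_one (MvPolynomial.C c), ← MvPolynomial.smul_eq_C_mul, map_smul, map_smul,
      LinearMap.smul_apply, mode_one, constantCoeff_smul, constantCoeff_smul,
      constantCoeff_mode_one_right]
    split_ifs with hn
    · rw [hn]
      simp
    · simp
  | add a b ha hb =>
    rw [map_add, map_add, map_add, LinearMap.add_apply, map_add, ha, hb, smul_add]
  | mul_X a k ih =>
    obtain ⟨N, hN⟩ := exists_mode_X_mul_eq k a n v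
    obtain ⟨N', hN'⟩ := exists_divDerivLin_eq_zero k v
    -- This is the shadow of skew-symmetry Y(u,z)v = e^{zL(-1)}Y(v,-z)u on constant terms. On one
    -- side only the annihilation half of the recursion is left.
    have e1 : MvPolynomial.constantCoeff (mode n (MvPolynomial.X k * a) v)
        = ∑ᶠ i : ℕ, MvPolynomial.constantCoeff (mode (n - 1 - i) a (divDerivLin k i v)) := by
      rw [hN (N + N') (by omega), finsum_eq_sum_range (N := N + N')]
      · simp only [map_add, map_sum, constantCoeff_divDerivLin_neg, Finset.sum_const_zero, zero_add]
      · intro i hi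
        rw [hN' _ (by omega), map_zero, map_zero]
    -- On the other side, multiplication by `X k` is h_{-1-k}; moving it out of the second argument
    -- leaves only commutator terms. The two sums then match term by term after shifting the index
    -- by `k`.
    have e2 := congrArg MvPolynomial.constantCoeff (h_mode (-1 - k) n v a)
    obtain ⟨N2, h2⟩ := exists_h_eq_zero v
    rw [h_neg, h_neg, map_sub, map_mul, MvPolynomial.constantCoeff_X, zero_mul, zero_sub,
      finsum_eq_sum_range (N := N2), map_sum] at e2
    · rw [mul_comm a, e1, finsum_eq_finsum_add_nat (k := k), finsum_eq_sum_range (N := N2),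
        ← neg_neg (MvPolynomial.constantCoeff (mode n v _)), e2, smul_neg, Finset.smul_sum,
        ← Finset.sum_neg_distrib]
      · refine Finset.sum_congr rfl fun i _ => ?_
        rw [ih, divDerivLin_apply, show ((i + k : ℕ) : ℤ) - k = i by push_cast; ring, map_zsmul,
          LinearMap.smul_apply, map_zsmul, map_zsmul, smul_smul, smul_smul, ← neg_smul,
          show n - 1 - ((i + k : ℕ) : ℤ) = -1 - k + n - i by push_cast; ring]
        congr 1
        have hc : Ring.choose (-1 - (k : ℤ)) i = (i : ℤ).negOnePow * Ring.choose ((i + k : ℕ) : ℤ) k := by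
          rw [show -1 - (k : ℤ) = -(k + 1) by ring, Ring.choose_neg, Units.smul_def, smul_eq_mul,
            show (k : ℤ) + 1 + i - 1 = ((i + k : ℕ) : ℤ) by push_cast; ring, Ring.choose_natCast,
            Ring.choose_natCast, Nat.choose_symm_add]
        have hs : (-1) ^ k * ((-1 - k + n - i + 1 : ℤ).negOnePow : ℤ)
            = -((n + 1).negOnePow * ((i : ℤ).negOnePow : ℤ)) := by
          rw [show (-1 - k + n - i + 1 : ℤ) = n + 1 - i - (k + 1) by ring, Int.negOnePow_sub,
            Int.negOnePow_sub, Int.negOnePow_succ (k : ℤ), Int.negOnePow_def (k : ℤ), zpow_natCast]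
          have hk : ((-1 : ℤ) ^ k) * (-1) ^ k = 1 := by rw [← mul_pow]; simp
          push_cast
          linear_combination (-((n + 1).negOnePow : ℤ) * ((i : ℤ).negOnePow : ℤ)) * hk
        rw [hc]
        linear_combination (Ring.choose ((i + k : ℕ) : ℤ) k) * hs
      · intro i hi
        rw [divDerivLin_apply, h2 _ (by push_cast; omega), smul_zero, map_zero, map_zero]
      · intro i hi
        rw [divDerivLin_natCast_of_lt hi, map_zero, map_zero]
    · intro i hi
      rw [h2 _ (by exact_mod_cast hi), map_zero, LinearMap.zero_apply, smul_zero]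

/-! ### The conformal vector -/

theorem h_conformalVector {j : ℤ} (hj : 0 ≤ j) :
    h j (conformalVector p) = if j = 1 then MvPolynomial.X 0 else 0 := by
  rw [conformalVector, h_map_smul, pow_two, h_X_mul, ← mul_one (MvPolynomial.X 0), h_X_mul,
    h_one hj]
  split_ifs with h1 h2 h2
  · subst h1
    rw [Nat.cast_zero, zero_add, one_smul, one_smul, mul_zero, zero_add, mul_one, mul_one,
      ← two_smul ℚ_[p], smul_smul]
    norm_num
  · exact absurd h1 (by simpa using h2)
  · exact absurd h2 (by simpa using h1)
  · rw [mul_zero, zero_add, mul_zero, zero_add, smul_zero]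

/-- `[h_m, ω_n] = m h_{m + n - 1}`. -/
theorem h_mode_conformalVector (m n : ℤ) (b : HeisenbergFock p) :
    h m (mode n (conformalVector p) b) - mode n (conformalVector p) (h m b)
      = m • h (m + n - 1) b := by
  rw [h_mode, finsum_eq_single _ 1]
  · rw [Nat.cast_one, h_conformalVector zero_le_one, if_pos rfl, mode_X_zero, Ring.choose_one_right]
  · intro i hi
    rw [h_conformalVector (by omega), if_neg (by exact_mod_cast hi), map_zero, LinearMap.zero_apply,
      smul_zero]

theorem mode_conformalVector_X_mul (n : ℤ) (k : ℕ) (b : HeisenbergFock p) :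
    mode n (conformalVector p) (MvPolynomial.X k * b)
      = MvPolynomial.X k * mode n (conformalVector p) b + ((k : ℤ) + 1) • h (n - 2 - k) b := by
  have h := h_mode_conformalVector (-1 - k) n b
  rw [h_neg, h_neg, sub_eq_iff_eq_add] at h
  rw [h, show -1 - (k : ℤ) + n - 1 = n - 2 - k by ring]
  module

/-- L(-1) kills 1, and its commutator with `X k` is multiplication by (k + 1) X_{k+1}. -/
theorem constantCoeff_mode_zero_conformalVector (b : HeisenbergFock p) :
    MvPolynomial.constantCoeff (mode 0 (conformalVector p) b) = 0 := by
  induction b using MvPolynomial.induction_on with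
  | C c =>
    rw [← mul_one (MvPolynomial.C c), ← MvPolynomial.smul_eq_C_mul, map_smul,
      mode_one_right_of_nonneg le_rfl, smul_zero, map_zero]
  | add a b ha hb => rw [map_add, map_add, ha, hb, add_zero]
  | mul_X a k ha =>
    rw [mul_comm, mode_conformalVector_X_mul, map_add, map_mul, MvPolynomial.constantCoeff_X,
      zero_mul, map_zsmul, show 0 - 2 - (k : ℤ) = -1 - ((k + 1 : ℕ) : ℤ) by push_cast; ring, h_neg,
      map_mul, MvPolynomial.constantCoeff_X, zero_mul, smul_zero, add_zero]

/-- `[ω_0, v_n] = -n v_{n-1}`. -/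
theorem mode_zero_conformalVector_mode (v : HeisenbergFock p) (n : ℤ) (b : HeisenbergFock p) :
    mode 0 (conformalVector p) (mode n v b) - mode n v (mode 0 (conformalVector p) b)
      = (-n) • mode (n - 1) v b := by
  induction v using annihilation_induction generalizing n b with
  | zero => simp
  | step v ih =>
    set T : HeisenbergFock p →ₗ[ℚ_[p]] HeisenbergFock p := mode 0 (conformalVector p) with hT
    have hTh : ∀ m b, h m (T b) = T (h m b) + m • h (m - 1) b := fun m b => by
      rw [← sub_eq_iff_eq_add', hT, h_mode_conformalVector, add_zero]
    -- The defect commutes with every h_m: the terms with h_j v cancel by induction. At 1 its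
    -- constant term can only come from n v(n-1)1, which needs n = 0 and then carries the factor 0.
    have key := isLinearMap_eq_zero (X := fun b => T (mode n v b) - mode n v (T b)
      + n • mode (n - 1) v b) ?_ ?_ ?_ b
    · rw [neg_smul]
      exact eq_neg_of_add_eq_zero_left key
    · exact ⟨fun x y => by simp only [map_add, smul_add]; abel,
        fun c x => by simp only [map_smul, smul_add, smul_sub, smul_comm c]⟩
    · intro m b
      obtain ⟨J, hJ⟩ := exists_h_eq_zero v
      have hc : ∀ (m n : ℤ) (b : HeisenbergFock p), h m (mode n v b) = mode n v (h m b)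
          + ∑ j ∈ Finset.range (J + 1), Ring.choose m j • mode (m + n - j) (h j v) b := by
        intro m n b
        rw [← sub_eq_iff_eq_add', h_mode, finsum_eq_sum_range fun i hi => ?_]
        rw [hJ _ (by omega), map_zero, LinearMap.zero_apply, smul_zero]
      have e1 : ∑ j ∈ Finset.range (J + 1), Ring.choose m j • T (mode (m + n - j) (h j v) b)
          = (∑ j ∈ Finset.range (J + 1), Ring.choose m j • mode (m + n - j) (h j v) (T b))
            - m • (∑ j ∈ Finset.range (J + 1),
                Ring.choose (m - 1) j • mode (m - 1 + n - j) (h j v) b)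
            - n • ∑ j ∈ Finset.range (J + 1),
                Ring.choose m j • mode (m + (n - 1) - j) (h j v) b := by
        rw [Finset.smul_sum, Finset.smul_sum, ← Finset.sum_sub_distrib, ← Finset.sum_sub_distrib]
        refine Finset.sum_congr rfl fun j _ => ?_
        rw [sub_eq_iff_eq_add.1 (ih j (m + n - j) b), smul_smul m, ← sub_mul_choose,
          show m - 1 + n - (j : ℤ) = m + n - j - 1 by ring,
          show m + (n - 1) - (j : ℤ) = m + n - j - 1 by ring]
        module
      rw [h_map_add, ← hLin_apply m (_ - _), map_sub, hLin_apply, hLin_apply, h_map_zsmul, hTh, hc, hc,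
        hc, hc, hTh, map_add, map_sum]
      simp only [map_zsmul, map_add, smul_add, e1]
      abel
    · rw [mode_one_right_of_nonneg le_rfl, map_add, map_sub, hT,
        constantCoeff_mode_zero_conformalVector, map_zero, map_zero, sub_zero, zero_add, map_zsmul,
        constantCoeff_mode_one_right]
      split_ifs with hn
      · rw [show n = 0 by omega, zero_smul]
      · rw [smul_zero]

/-! ### The Jacobi identity on the Fock space -/

theorem isTruncated_mode_mode_left (u v w : HeisenbergFock p) :
    IsTruncated fun b c => mode c (mode b u v) w := by
  obtain ⟨N, hN⟩ := exists_mode_eq_zero u v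
  exact ⟨N, fun b hb c => by simp only [hN b hb, map_zero, LinearMap.zero_apply]⟩

theorem isTruncated_mode_mode_right (u v w : HeisenbergFock p) :
    IsTruncated fun b c => mode c u (mode b v w) := by
  obtain ⟨N, hN⟩ := exists_mode_eq_zero v w
  exact ⟨N, fun b hb c => by simp only [hN b hb, map_zero]⟩

/-- The left-hand side `∑ (r choose i) (u(t+i)v)(r+s-i) w` of the Jacobi identity. -/
noncomputable def iterateSum (u v w : HeisenbergFock p) (r s t : ℤ) : HeisenbergFock p :=
  binomialSum 1 (fun b c => mode c (mode b u v) w) r t s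

/-- The first half `∑ (-1)^i (t choose i) u(r+t-i) v(s+i) w` of the right-hand side of the Jacobi
identity. -/
noncomputable def productSum (u v w : HeisenbergFock p) (r s t : ℤ) : HeisenbergFock p :=
  binomialSum (-1) (fun b c => mode c u (mode b v w)) t s r

/-- The difference of the two sides of the Jacobi identity. -/
noncomputable def jacobiDefect (u v w : HeisenbergFock p) (r s t : ℤ) : HeisenbergFock p :=
  iterateSum u v w r s t - productSum u v w r s t + (t.negOnePow : ℤ) • productSum v u w s r t

/-- Pascal's rule in `r` for the iterate and in `t` for the two products; the sign (-1)^t aligns the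
third part with the others. -/
theorem jacobiDefect_succ (u v w : HeisenbergFock p) (r s t : ℤ) :
    jacobiDefect u v w (r + 1) s t
      = jacobiDefect u v w r (s + 1) t + jacobiDefect u v w r s (t + 1) := by
  simp only [jacobiDefect, iterateSum, productSum, Int.negOnePow_succ]
  rw [binomialSum_succ (isTruncated_mode_mode_left u v w),
    binomialSum_succ (isTruncated_mode_mode_right u v w),
    binomialSum_succ (isTruncated_mode_mode_right v u w)]
  push_cast
  module

theorem isLinearMap_binomialSum {f : HeisenbergFock p → ℤ → ℤ → HeisenbergFock p}
    (hf : ∀ w, IsTruncated (f w)) (hlin : ∀ b c, IsLinearMap ℚ_[p] fun w => f w b c) (ε a b c : ℤ) :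
    IsLinearMap ℚ_[p] fun w => binomialSum ε (f w) a b c where
  map_add x y := by
    rw [← binomialSum_add (hf x) (hf y)]
    congr 1
    funext b c
    exact (hlin b c).map_add x y
  map_smul k x := by
    have h := map_binomialSum (ε := ε) (hf x) (DistribSMul.toAddMonoidHom _ k) a b c
    refine Eq.trans ?_ h.symm
    congr 1
    funext b c
    exact (hlin b c).map_smul k x

theorem isLinearMap_iterateSum (u v : HeisenbergFock p) (r s t : ℤ) :
    IsLinearMap ℚ_[p] fun w => iterateSum u v w r s t :=
  isLinearMap_binomialSum (fun w => isTruncated_mode_mode_left u v w)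
    (fun b c => (mode c (mode b u v)).isLinear) 1 r t s

theorem isLinearMap_productSum (u v : HeisenbergFock p) (r s t : ℤ) :
    IsLinearMap ℚ_[p] fun w => productSum u v w r s t :=
  isLinearMap_binomialSum (fun w => isTruncated_mode_mode_right u v w)
    (fun b c => ((mode c u).comp (mode b v)).isLinear) (-1) t s r

theorem isLinearMap_jacobiDefect (u v : HeisenbergFock p) (r s t : ℤ) :
    IsLinearMap ℚ_[p] fun w => jacobiDefect u v w r s t where
  map_add x y := by
    simp only [jacobiDefect, (isLinearMap_iterateSum u v r s t).map_add,
      (isLinearMap_productSum u v r s t).map_add, (isLinearMap_productSum v u s r t).map_add,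
      smul_add]
    abel
  map_smul c x := by
    simp only [jacobiDefect, (isLinearMap_iterateSum u v r s t).map_smul,
      (isLinearMap_productSum u v r s t).map_smul, (isLinearMap_productSum v u s r t).map_smul,
      smul_add, smul_sub, smul_comm c]

theorem h_mode_eq_sum {a : HeisenbergFock p} {J : ℕ} (hJ : ∀ j : ℕ, J ≤ j → h j a = 0) (m n : ℤ)
    (b : HeisenbergFock p) : h m (mode n a b) = mode n a (h m b)
      + ∑ j ∈ Finset.range J, Ring.choose m j • mode (m + n - j) (h j a) b := by
  rw [← sub_eq_iff_eq_add', h_mode, finsum_eq_sum_range fun i hi => ?_]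
  rw [hJ i hi, map_zero, LinearMap.zero_apply, smul_zero]

theorem linearMap_binomialSum {ε : ℤ} {f : ℤ → ℤ → HeisenbergFock p} (hf : IsTruncated f)
    (X : HeisenbergFock p →ₗ[ℚ_[p]] HeisenbergFock p) (a b c : ℤ) :
    X (binomialSum ε f a b c) = binomialSum ε (fun b c => X (f b c)) a b c :=
  map_binomialSum hf X.toAddMonoidHom a b c

theorem h_binomialSum {ε : ℤ} {f : ℤ → ℤ → HeisenbergFock p} (hf : IsTruncated f) (m a b c : ℤ) :
    h m (binomialSum ε f a b c) = binomialSum ε (fun b c => h m (f b c)) a b c :=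
  linearMap_binomialSum hf (hLin m) a b c

section Commutators

variable {u v : HeisenbergFock p} {J : ℕ}

/-- The shifts by m - j commute with forming binomial sums. The iterate obeys a formula of the same
shape, so the defect does as well. -/
theorem h_productSum (hu : ∀ j : ℕ, J ≤ j → h j u = 0) (hv : ∀ j : ℕ, J ≤ j → h j v = 0)
    (m : ℤ) (w : HeisenbergFock p) (r s t : ℤ) :
    h m (productSum u v w r s t) = productSum u v (h m w) r s t
      + ∑ j ∈ Finset.range J, Ring.choose m j • (productSum (h j u) v w (r + (m - j)) s t
        + productSum u (h j v) w r (s + (m - j)) t) := by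
  have h1 := fun j : ℕ => isTruncated_mode_mode_right (h j u) v w
  have h2 := fun j : ℕ => isTruncated_mode_mode_right u (h j v) w
  have e : ∀ b c, h m (mode c u (mode b v w)) = mode c u (mode b v (h m w))
      + ∑ j ∈ Finset.range J, Ring.choose m j • (mode (c + (m - j)) (h j u) (mode (b + 0) v w)
        + mode (c + 0) u (mode (b + (m - j)) (h j v) w)) := by
    intro b c
    rw [h_mode_eq_sum hu, h_mode_eq_sum hv, map_add, map_sum, add_assoc, ← Finset.sum_add_distrib]
    congr 1
    refine Finset.sum_congr rfl fun j _ => ?_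
    rw [map_zsmul, ← smul_add, add_comm, add_zero, add_zero, show m + c - (j : ℤ) = c + (m - j) by ring,
      show m + b - (j : ℤ) = b + (m - j) by ring]
  have hs : ∀ j ∈ Finset.range J, IsTruncated fun b c => Ring.choose m j •
      (mode (c + (m - j)) (h j u) (mode (b + 0) v w)
        + mode (c + 0) u (mode (b + (m - j)) (h j v) w)) := fun j _ =>
    (((h1 j).shift 0 (m - j)).add ((h2 j).shift (m - j) 0)).zsmul _
  rw [productSum, h_binomialSum (isTruncated_mode_mode_right u v w)]
  simp only [e]
  rw [binomialSum_add (isTruncated_mode_mode_right u v _) (IsTruncated.sum _ hs),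
    binomialSum_sum _ hs]
  congr 1
  refine Finset.sum_congr rfl fun j _ => ?_
  rw [binomialSum_zsmul (((h1 j).shift 0 (m - j)).add ((h2 j).shift (m - j) 0)),
    binomialSum_add ((h1 j).shift 0 (m - j)) ((h2 j).shift (m - j) 0),
    binomialSum_shift (f := fun b c => mode c (h j u) (mode b v w)),
    binomialSum_shift (f := fun b c => mode c u (mode b (h j v) w)), add_zero, add_zero]
  rfl

/-- The commutator formula is used twice, for the state u(b)v and then inside it. The weights (m
choose j)(j choose k) regroup into (m choose k) times a binomial sum with upper index m - k. -/
theorem h_mode_mode (hu : ∀ j : ℕ, J ≤ j → h j u = 0) (hv : ∀ j : ℕ, J ≤ j → h j v = 0)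
    (m b c : ℤ) (w : HeisenbergFock p) :
    h m (mode c (mode b u v) w) = mode c (mode b u v) (h m w)
      + ∑ j ∈ Finset.range J, Ring.choose m j • (
        binomialSum 1 (fun b c => mode c (mode b (h j u) v) w) (m - j) b c
        + mode (c + (m - j)) (mode (b + 0) u (h j v)) w) := by
  have hfin : ∀ k : ℕ, (fun j : ℕ => (Ring.choose m j * Ring.choose (j : ℤ) k) •
      mode (m + c - j) (mode (b + j - k) (h k u) v) w).HasFiniteSupport := by
    intro k
    obtain ⟨N, hN⟩ := exists_mode_eq_zero (h k u) v
    refine hasFiniteSupport_of_forall_le (N := (N - b + k).toNat) fun i hi => ?_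
    rw [hN _ (by omega), map_zero, LinearMap.zero_apply, smul_zero]
  have hfin' : (fun j : ℕ => Ring.choose m j • mode (m + c - j) (mode b u (h j v)) w).HasFiniteSupport :=
    hasFiniteSupport_of_forall_le (N := J) fun i hi => by
      rw [hv i hi, map_zero, map_zero, LinearMap.zero_apply, smul_zero]
  have e : ∀ j : ℕ, Ring.choose m j • mode (m + c - j) (h j (mode b u v)) w
      = Ring.choose m j • mode (m + c - j) (mode b u (h j v)) w
        + ∑ k ∈ Finset.range J, (Ring.choose m j * Ring.choose (j : ℤ) k) •
          mode (m + c - j) (mode (b + j - k) (h k u) v) w := by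
    intro j
    rw [h_mode_eq_sum hu, map_add, LinearMap.add_apply, smul_add, map_sum, LinearMap.sum_apply,
      Finset.smul_sum]
    congr 1
    refine Finset.sum_congr rfl fun k _ => ?_
    rw [map_zsmul, LinearMap.smul_apply, smul_smul, add_comm b]
  rw [← sub_eq_iff_eq_add', h_mode, finsum_congr e, finsum_add_distrib hfin', finsum_sum_comm]
  · rw [finsum_eq_sum_range (N := J), ← Finset.sum_add_distrib]
    · refine Finset.sum_congr rfl fun k _ => ?_
      rw [finsum_choose_mul_choose_smul (g := fun b c => mode c (mode b (h k u) v) w)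
        (isTruncated_mode_mode_left _ _ _), ← smul_add, add_comm, add_zero,
        show m + c - (k : ℤ) = c + (m - k) by ring]
    · intro i hi
      rw [hv i hi, map_zero, map_zero, LinearMap.zero_apply, smul_zero]
  · exact fun k _ => hfin k
  · refine hasFiniteSupport_of_forall_le (N := ((Finset.range J).sup fun k =>
      ((hfin k).bddAbove.choose + 1))) fun i hi => Finset.sum_eq_zero fun k hk => ?_
    by_contra hne
    have h1 := (hfin k).bddAbove.choose_spec hne
    have h2 := (Finset.le_sup (f := fun k => (hfin k).bddAbove.choose + 1) hk).trans hi
    omega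

/-- The inner binomial sum with upper index m - j merges with the outer one, and `r` becomes r + (m
- j). -/
theorem h_iterateSum (hu : ∀ j : ℕ, J ≤ j → h j u = 0) (hv : ∀ j : ℕ, J ≤ j → h j v = 0)
    (m : ℤ) (w : HeisenbergFock p) (r s t : ℤ) :
    h m (iterateSum u v w r s t) = iterateSum u v (h m w) r s t
      + ∑ j ∈ Finset.range J, Ring.choose m j • (iterateSum (h j u) v w (r + (m - j)) s t
        + iterateSum u (h j v) w r (s + (m - j)) t) := by
  have h1 := fun j : ℕ => isTruncated_mode_mode_left (h j u) v w
  have h2 := fun j : ℕ => isTruncated_mode_mode_left u (h j v) w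
  have h3 := fun j : ℕ => ((h1 j).binomialSum 1 (m - j)).add ((h2 j).shift 0 (m - j))
  have hs := fun j (_ : j ∈ Finset.range J) => (h3 j).zsmul fun _ _ => Ring.choose m j
  rw [iterateSum, h_binomialSum (isTruncated_mode_mode_left u v w)]
  simp only [h_mode_mode hu hv]
  rw [binomialSum_add (isTruncated_mode_mode_left u v _) (IsTruncated.sum _ hs),
    binomialSum_sum _ hs]
  congr 1
  refine Finset.sum_congr rfl fun j _ => ?_
  rw [binomialSum_zsmul (h3 j), binomialSum_add ((h1 j).binomialSum 1 (m - j)) ((h2 j).shift 0 (m - j)),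
    binomialSum_shift (f := fun b c => mode c (mode b u (h j v)) w),
    binomialSum_binomialSum (h1 j), add_zero]
  rfl

theorem h_jacobiDefect (hu : ∀ j : ℕ, J ≤ j → h j u = 0) (hv : ∀ j : ℕ, J ≤ j → h j v = 0)
    (m : ℤ) (w : HeisenbergFock p) (r s t : ℤ) :
    h m (jacobiDefect u v w r s t) = jacobiDefect u v (h m w) r s t
      + ∑ j ∈ Finset.range J, Ring.choose m j • (jacobiDefect (h j u) v w (r + (m - j)) s t
        + jacobiDefect u (h j v) w r (s + (m - j)) t) := by
  have e : ∀ j ∈ Finset.range J, Ring.choose m j • (jacobiDefect (h j u) v w (r + (m - j)) s t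
        + jacobiDefect u (h j v) w r (s + (m - j)) t)
      = Ring.choose m j • (iterateSum (h j u) v w (r + (m - j)) s t
          + iterateSum u (h j v) w r (s + (m - j)) t)
        - Ring.choose m j • (productSum (h j u) v w (r + (m - j)) s t
          + productSum u (h j v) w r (s + (m - j)) t)
        + (t.negOnePow : ℤ) • Ring.choose m j • (productSum (h j v) u w (s + (m - j)) r t
          + productSum v (h j u) w s (r + (m - j)) t) := fun j _ => by
    simp only [jacobiDefect]
    module
  rw [Finset.sum_congr rfl e, Finset.sum_add_distrib, Finset.sum_sub_distrib, ← Finset.smul_sum,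
    jacobiDefect, h_map_add, h_map_zsmul, ← hLin_apply m (_ - _), map_sub, hLin_apply, hLin_apply,
    h_productSum hv hu, h_iterateSum hu hv, h_productSum hu hv, jacobiDefect]
  module

end Commutators

theorem mode_zero_conformalVector_binomialSum {ε : ℤ} {f : ℤ → ℤ → HeisenbergFock p}
    (hf : IsTruncated f) (a b c : ℤ) : mode 0 (conformalVector p) (binomialSum ε f a b c)
      = binomialSum ε (fun b c => mode 0 (conformalVector p) (f b c)) a b c :=
  linearMap_binomialSum hf _ a b c

theorem mode_zero_conformalVector_iterateSum (u v w : HeisenbergFock p) (r s t : ℤ) :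
    mode 0 (conformalVector p) (iterateSum u v w r s t)
      = iterateSum u v (mode 0 (conformalVector p) w) r s t
        - (r • iterateSum u v w (r - 1) s t + s • iterateSum u v w r (s - 1) t) := by
  have h1 := isTruncated_mode_mode_left u v w
  have e : ∀ b c, mode 0 (conformalVector p) (mode c (mode b u v) w)
      = mode c (mode b u v) (mode 0 (conformalVector p) w)
        - c • mode (c - 1) (mode b u v) w := fun b c => by
    rw [sub_eq_iff_eq_add'.1 (mode_zero_conformalVector_mode (mode b u v) c w)]
    module
  rw [iterateSum, mode_zero_conformalVector_binomialSum h1]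
  simp only [e]
  have h2 : IsTruncated fun b c : ℤ => c • mode (c - 1) (mode b u v) w := by
    simpa only [add_zero, sub_eq_add_neg] using (h1.shift 0 (-1)).zsmul fun _ c => c
  rw [binomialSum_sub (isTruncated_mode_mode_left u v _) h2, binomialSum_one_derivation h1]
  rfl

theorem mode_zero_conformalVector_productSum (u v w : HeisenbergFock p) (r s t : ℤ) :
    mode 0 (conformalVector p) (productSum u v w r s t)
      = productSum u v (mode 0 (conformalVector p) w) r s t
        - (r • productSum u v w (r - 1) s t + s • productSum u v w r (s - 1) t) := by
  have h1 := isTruncated_mode_mode_right u v w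
  have e : ∀ b c, mode 0 (conformalVector p) (mode c u (mode b v w))
      = mode c u (mode b v (mode 0 (conformalVector p) w))
        - (c • mode (c - 1) u (mode b v w) + b • mode c u (mode (b - 1) v w)) := fun b c => by
    rw [sub_eq_iff_eq_add'.1 (mode_zero_conformalVector_mode u c _),
      sub_eq_iff_eq_add'.1 (mode_zero_conformalVector_mode v b w), map_add, map_zsmul]
    module
  rw [productSum, mode_zero_conformalVector_binomialSum h1]
  simp only [e]
  have h2 : IsTruncated fun b c : ℤ => c • mode (c - 1) u (mode b v w)
      + b • mode c u (mode (b - 1) v w) := by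
    simpa only [add_zero, sub_eq_add_neg] using
      ((h1.shift 0 (-1)).zsmul fun _ c => c).add ((h1.shift (-1) 0).zsmul fun b _ => b)
  rw [binomialSum_sub (isTruncated_mode_mode_right u v _) h2, binomialSum_neg_one_derivation h1]
  rfl

/-- L(-1) acts on all three parts by the same formula: only the outer mode of the iterate is
differentiated, and both modes of each product. -/
theorem mode_zero_conformalVector_jacobiDefect (u v w : HeisenbergFock p) (r s t : ℤ) :
    mode 0 (conformalVector p) (jacobiDefect u v w r s t)
      = jacobiDefect u v (mode 0 (conformalVector p) w) r s t
        - (r • jacobiDefect u v w (r - 1) s t + s • jacobiDefect u v w r (s - 1) t) := by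
  simp only [jacobiDefect]
  rw [map_add, map_sub, map_zsmul, mode_zero_conformalVector_iterateSum,
    mode_zero_conformalVector_productSum, mode_zero_conformalVector_productSum]
  module

theorem productSum_one_right_of_nonneg (u v : HeisenbergFock p) (r : ℤ) {s : ℤ} (hs : 0 ≤ s)
    (t : ℤ) : productSum u v 1 r s t = 0 :=
  binomialSum_eq_zero (N := 0) (fun b hb c => by rw [mode_one_right_of_nonneg hb, map_zero]) hs _ _

theorem productSum_one_right_neg_one (u v : HeisenbergFock p) (r t : ℤ) :
    productSum u v 1 r (-1) t = mode (t + r) u v := by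
  rw [productSum, binomialSum, finsum_eq_single _ 0]
  · rw [pow_zero, Ring.choose_zero_right, mul_one, one_smul, Nat.cast_zero, add_zero, sub_zero,
      mode_neg_one_one_right]
  · intro i hi
    rw [mode_one_right_of_nonneg (by omega), map_zero, smul_zero]

/-- The iterate and the first product both reduce to u(t)v by the creation axiom, and the second
product contains only u(i)1 with i ≥ 0. -/
theorem jacobiDefect_one_zero_neg_one (u v : HeisenbergFock p) (t : ℤ) :
    jacobiDefect u v 1 0 (-1) t = 0 := by
  rw [jacobiDefect, productSum_one_right_neg_one, productSum_one_right_of_nonneg _ _ _ le_rfl,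
    iterateSum, binomialSum_zero, mode_neg_one_one_right, add_zero, sub_self, smul_zero, add_zero]

/-- The first product vanishes since v(s+i)1 = 0. In the iterate only i = s has a constant term,
with weight (-1 choose s) = (-1)^s; the rest is skew-symmetry of constant terms. -/
theorem constantCoeff_jacobiDefect_one_neg_one (u v : HeisenbergFock p) {s : ℤ} (hs : 0 ≤ s)
    (t : ℤ) : MvPolynomial.constantCoeff (jacobiDefect u v 1 (-1) s t) = 0 := by
  have e : MvPolynomial.constantCoeff (iterateSum u v 1 (-1) s t)
      = (s.negOnePow : ℤ) • MvPolynomial.constantCoeff (mode (t + s) u v) := by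
    have h := map_binomialSum (ε := 1) (isTruncated_mode_mode_left u v 1)
      (MvPolynomial.constantCoeff (R := ℚ_[p])).toAddMonoidHom (-1) t s
    refine h.trans ?_
    simp only [RingHom.toAddMonoidHom_eq_coe, AddMonoidHom.coe_coe, constantCoeff_mode_one_right]
    rw [binomialSum, finsum_eq_single _ s.toNat]
    · rw [if_pos (by omega), one_pow, one_mul, Ring.choose_neg, add_sub_cancel_left,
        Ring.choose_natCast, Nat.choose_self, Units.smul_def, smul_eq_mul, Nat.cast_one, mul_one,
        Int.toNat_of_nonneg hs]
    · intro i hi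
      rw [if_neg (by omega), smul_zero]
  rw [jacobiDefect, productSum_one_right_neg_one, productSum_one_right_of_nonneg _ _ _ hs, map_add,
    map_sub, e, map_zero, sub_zero, map_zsmul, constantCoeff_mode_comm, smul_smul, ← add_smul,
    Int.negOnePow_succ, Int.negOnePow_add]
  have h2 : ((s.negOnePow : ℤˣ) : ℤ) * s.negOnePow = 1 := by
    rw [← Units.val_mul, ← Int.negOnePow_add, Int.negOnePow_even _ ⟨s, rfl⟩, Units.val_one]
  convert zero_smul ℤ _
  push_cast
  linear_combination (-(t.negOnePow : ℤ)) * h2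

theorem jacobiDefect_zero_left (v w : HeisenbergFock p) (r s t : ℤ) :
    jacobiDefect 0 v w r s t = 0 := by
  simp [jacobiDefect, iterateSum, productSum, binomialSum]

theorem jacobiDefect_zero_right (u w : HeisenbergFock p) (r s t : ℤ) :
    jacobiDefect u 0 w r s t = 0 := by
  simp [jacobiDefect, iterateSum, productSum, binomialSum]

/-- The Jacobi identity for the Heisenberg vertex algebra. -/
theorem jacobiDefect_eq_zero (u v w : HeisenbergFock p) (r s t : ℤ) :
    jacobiDefect u v w r s t = 0 := by
  induction u using annihilation_induction generalizing v w r s t with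
  | zero => exact jacobiDefect_zero_left v w r s t
  | step u ihu =>
  induction v using annihilation_induction generalizing w r s t with
  | zero => exact jacobiDefect_zero_right u w r s t
  | step v ihv =>
    have hcomm : ∀ r s t m w, h m (jacobiDefect u v w r s t) = jacobiDefect u v (h m w) r s t := by
      intro r s t m w
      obtain ⟨N1, h1⟩ := exists_h_eq_zero u
      obtain ⟨N2, h2⟩ := exists_h_eq_zero v
      rw [h_jacobiDefect (J := N1 + N2) (fun j hj => h1 _ (by omega)) (fun j hj => h2 _ (by omega)),
        Finset.sum_eq_zero, add_zero]
      intro j _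
      rw [ihu, ihv, add_zero, smul_zero]
    set c : ℤ → ℤ → ℤ → ℚ_[p] := fun r s t =>
      MvPolynomial.constantCoeff (jacobiDefect u v 1 r s t) with hc
    have hscalar : ∀ r s t w, jacobiDefect u v w r s t = c r s t • w := fun r s t w =>
      isLinearMap_eq_smul (isLinearMap_jacobiDefect u v r s t) (hcomm r s t) w
    have hsucc : ∀ r s t, c (r + 1) s t = c r (s + 1) t + c r s (t + 1) := fun r s t => by
      simp only [hc, jacobiDefect_succ, map_add]
    -- Constant terms of the L(-1) identity at w = 1: both L(-1)1 and the constant term on the left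
    -- vanish.
    have htrans : ∀ r s t : ℤ, (r : ℚ_[p]) * c (r - 1) s t + s * c r (s - 1) t = 0 := by
      intro r s t
      have h := congrArg MvPolynomial.constantCoeff
        (mode_zero_conformalVector_jacobiDefect u v 1 r s t)
      rw [constantCoeff_mode_zero_conformalVector, mode_one_right_of_nonneg le_rfl,
        (isLinearMap_jacobiDefect u v r s t).map_zero, zero_sub, map_neg, zero_eq_neg, map_add,
        map_zsmul, map_zsmul, zsmul_eq_mul, zsmul_eq_mul] at h
      exact h
    have h0 : ∀ s t, c 0 s t = 0 := by
      intro s t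
      by_cases hs : s = -1
      · rw [hs, hc]
        simp only [jacobiDefect_one_zero_neg_one, map_zero]
      · have h := htrans 0 (s + 1) t
        rw [Int.cast_zero, zero_mul, zero_add, add_sub_cancel_right] at h
        exact (mul_eq_zero.1 h).resolve_left (by exact_mod_cast fun h => hs (by omega))
    -- Here `htrans` at r = 0 would give a zero factor. Instead, descent on `s` starts from
    -- skew-symmetry for s ≥ 0 and uses `hsucc` at r = -1, whose left side is `c 0`.
    have h1 : ∀ s t, c (-1) s t = 0 := by
      have h1' : ∀ (k : ℕ) s t, -(k : ℤ) ≤ s → c (-1) s t = 0 := by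
        intro k
        induction k with
        | zero => exact fun s t hs => constantCoeff_jacobiDefect_one_neg_one u v (by simpa using hs) t
        | succ k ih =>
          intro s t hs
          have h := hsucc (-1) s (t - 1)
          rw [neg_add_cancel, h0, sub_add_cancel, ih (s + 1) _ (by push_cast at hs; omega),
            zero_add] at h
          exact h.symm
      exact fun s t => h1' s.natAbs s t (by omega)
    have hall : ∀ r s t, c r s t = 0 := by
      intro r
      induction r using Int.induction_on with
      | zero => exact h0
      | succ r ih => exact fun s t => by rw [hsucc, ih, ih, add_zero]
      | pred r ih =>
        intro s t
        by_cases hr : r = 0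
        · subst hr
          simpa using h1 s t
        · have h := htrans (-r) s t
          rw [ih, mul_zero, add_zero] at h
          refine (mul_eq_zero.1 h).resolve_left ?_
          push_cast
          exact neg_ne_zero.2 (Nat.cast_ne_zero.2 hr)
    rw [hscalar, hall, zero_smul]

/-! ### The Virasoro algebra on the Fock space -/

/-- The Jacobi identity at t = 0, where both product sums collapse to their first terms. -/
theorem mode_commutator (u v w : HeisenbergFock p) (r s : ℤ) :
    mode r u (mode s v w) - mode s v (mode r u w)
      = ∑ᶠ i : ℕ, Ring.choose r i • mode (r + s - i) (mode i u v) w := by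
  have h := jacobiDefect_eq_zero u v w r s 0
  rw [jacobiDefect, productSum, productSum, binomialSum_zero, binomialSum_zero, iterateSum,
    binomialSum, Int.negOnePow_zero, Units.val_one, one_smul, sub_add, sub_eq_zero] at h
  rw [← h]
  exact finsum_congr fun i => by rw [one_pow, one_mul, zero_add]

/-- `(ω_0 v)_n = -n v_{n-1}`. -/
theorem mode_mode_zero_conformalVector (v w : HeisenbergFock p) (n : ℤ) :
    mode n (mode 0 (conformalVector p) v) w = (-n) • mode (n - 1) v w := by
  rw [← mode_zero_conformalVector_mode, mode_commutator, finsum_eq_single _ 0]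
  · rw [Ring.choose_zero_right, one_smul, Nat.cast_zero, zero_add, sub_zero]
  · intro i hi
    rw [Ring.choose_zero_pos ℤ (Nat.pos_of_ne_zero hi), zero_smul]

theorem mode_conformalVector_conformalVector (n : ℕ) :
    mode n (conformalVector p) (conformalVector p) = (1 / 2 : ℚ_[p]) •
      (MvPolynomial.X 0 * h (n - 2) 1 + h (n - 2) (MvPolynomial.X 0)) := by
  have hX : (MvPolynomial.X 0 : HeisenbergFock p) ^ 2
      = MvPolynomial.X 0 * (MvPolynomial.X 0 * 1) := by ring
  have hω : conformalVector p
      = (1 / 2 : ℚ_[p]) • (MvPolynomial.X 0 * (MvPolynomial.X 0 * 1)) := by rw [← hX]; rfl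
  conv_lhs => arg 2; rw [hω]
  rw [map_smul, mode_conformalVector_X_mul, mode_conformalVector_X_mul,
    mode_one_right_of_nonneg (by omega), mul_zero, zero_add, Nat.cast_zero, zero_add, one_smul,
    one_smul, sub_zero, mul_one]

theorem mode_one_conformalVector_conformalVector :
    mode (1 : ℕ) (conformalVector p) (conformalVector p) = (2 : ℤ) • conformalVector p := by
  rw [mode_conformalVector_conformalVector,
    show ((1 : ℕ) : ℤ) - 2 = -1 - (0 : ℕ) by norm_num, h_neg, h_neg, mul_one, conformalVector,
    ← pow_two]
  module

theorem mode_two_conformalVector_conformalVector :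
    mode (2 : ℕ) (conformalVector p) (conformalVector p) = 0 := by
  rw [mode_conformalVector_conformalVector, show ((2 : ℕ) : ℤ) - 2 = 0 by norm_num, h_zero,
    h_zero, mul_zero, add_zero, smul_zero]

theorem h_X_zero {m : ℤ} (hm : 0 ≤ m) :
    h m (MvPolynomial.X 0 : HeisenbergFock p) = if m = 1 then 1 else 0 := by
  rw [← mul_one (MvPolynomial.X 0), h_X_mul, h_one hm, mul_zero, zero_add, Nat.cast_zero, zero_add]
  split_ifs with h1
  · rw [h1, one_smul]
  · rfl

theorem mode_three_conformalVector_conformalVector :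
    mode (3 : ℕ) (conformalVector p) (conformalVector p) = (1 / 2 : ℚ_[p]) • 1 := by
  rw [mode_conformalVector_conformalVector, h_one (by norm_num), h_X_zero (by norm_num),
    if_pos (by norm_num), mul_zero, zero_add]

theorem mode_conformalVector_conformalVector_of_four_le {n : ℕ} (hn : 4 ≤ n) :
    mode n (conformalVector p) (conformalVector p) = 0 := by
  rw [mode_conformalVector_conformalVector, h_one (by omega), h_X_zero (by omega),
    if_neg (by omega), mul_zero, zero_add, smul_zero]

theorem six_mul_choose_three (m : ℤ) : 6 * Ring.choose (m + 1) 3 = m ^ 3 - m := by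
  have h1 := succ_mul_choose_succ' (m + 1) 2
  have h2 := succ_mul_choose_succ' (m + 1) 1
  rw [Ring.choose_one_right] at h2
  push_cast at h1 h2
  linear_combination 2 * h1 + (m + 1 - 2) * h2

/-- The modes of the conformal vector satisfy the Virasoro relations with central charge `1`. -/
theorem mode_conformalVector_commutator (m n : ℤ) (b : HeisenbergFock p) :
    mode (m + 1) (conformalVector p) (mode (n + 1) (conformalVector p) b)
      - mode (n + 1) (conformalVector p) (mode (m + 1) (conformalVector p) b)
      = (m - n) • mode (m + n + 1) (conformalVector p) b
        + (if m + n = 0 then ((m : ℚ_[p]) ^ 3 - m) / 12 else 0) • b := by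
  rw [mode_commutator, finsum_eq_sum_range (N := 4), Finset.sum_range_succ, Finset.sum_range_succ,
    Finset.sum_range_succ, Finset.sum_range_one, mode_one_conformalVector_conformalVector,
    mode_two_conformalVector_conformalVector, mode_three_conformalVector_conformalVector,
    Nat.cast_zero, mode_mode_zero_conformalVector, map_zero, LinearMap.zero_apply, smul_zero,
    add_zero, map_smul (mode _) (1 / 2 : ℚ_[p]), LinearMap.smul_apply, mode_one, map_zsmul, LinearMap.smul_apply,
    Nat.cast_one, Ring.choose_zero_right, Ring.choose_one_right, one_smul]
  · congr 1
    · rw [show m + 1 + (n + 1) - 0 - 1 = m + n + 1 by ring,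
        show m + 1 + (n + 1) - 1 = m + n + 1 by ring]
      module
    -- The central term comes from ω(3)ω = 1/2: half of (m + 1 choose 3) is (m³ - m)/12.
    · by_cases hmn : m + n = 0
      · have hc : (6 : ℚ_[p]) * (Ring.choose (m + 1) 3 : ℤ) = (m : ℚ_[p]) ^ 3 - m := by
          exact_mod_cast congrArg (Int.cast : ℤ → ℚ_[p]) (six_mul_choose_three m)
        rw [if_pos (by push_cast; omega), if_pos hmn, ← Int.cast_smul_eq_zsmul ℚ_[p], smul_smul, ← hc]
        congr 1
        ring
      · rw [if_neg (by push_cast; omega), if_neg hmn, smul_zero, smul_zero, zero_smul]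
  · intro i hi
    rw [mode_conformalVector_conformalVector_of_four_le hi, map_zero, LinearMap.zero_apply, smul_zero]

/-! ### Conformal weights and the diagonal action of L(0) -/

/-- The conformal weight of a monomial. -/
noncomputable def monomialWeight (I : ℕ →₀ ℕ) : ℕ := I.sum fun k n => n * (k + 1)

theorem monomialWeight_single_add (k : ℕ) (I : ℕ →₀ ℕ) :
    monomialWeight (Finsupp.single k 1 + I) = k + 1 + monomialWeight I := by
  rw [monomialWeight, Finsupp.sum_add_index' (by simp) (by intros; ring), Finsupp.sum_single_index (by simp),
    one_mul]
  rfl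

theorem mode_one_conformalVector_monomial (I : ℕ →₀ ℕ) (c : ℚ_[p]) :
    mode 1 (conformalVector p) (MvPolynomial.monomial I c)
      = (monomialWeight I : ℚ_[p]) • MvPolynomial.monomial I c := by
  induction hn : monomialWeight I using Nat.strong_induction_on generalizing I with
  | _ n ih =>
  by_cases hI : I = 0
  · subst hI
    rw [MvPolynomial.monomial_zero', ← mul_one (MvPolynomial.C c), ← MvPolynomial.smul_eq_C_mul,
      map_smul, mode_one_right_of_nonneg zero_le_one, ← hn, smul_zero]
    simp [monomialWeight]
  · obtain ⟨k, hk⟩ := Finsupp.ne_iff.1 hI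
    obtain ⟨J, rfl⟩ : ∃ J, I = Finsupp.single k 1 + J :=
      exists_add_of_le (Finsupp.single_le_iff.2 (Nat.one_le_iff_ne_zero.2 hk))
    rw [monomialWeight_single_add] at hn
    have hX : MvPolynomial.monomial (Finsupp.single k 1 + J) c
        = MvPolynomial.X k * MvPolynomial.monomial J c := by
      rw [MvPolynomial.X, MvPolynomial.monomial_mul, one_mul]
    rw [hX, mode_conformalVector_X_mul, ih _ (by omega) J rfl, ← hn,
      show 1 - 2 - (k : ℤ) = -1 - k by ring, h_neg, mul_smul_comm, ← Int.cast_smul_eq_zsmul ℚ_[p],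
      ← add_smul]
    congr 1
    push_cast
    ring

theorem coeff_mode_one_conformalVector (I : ℕ →₀ ℕ) (b : HeisenbergFock p) :
    MvPolynomial.coeff I (mode 1 (conformalVector p) b)
      = monomialWeight I * MvPolynomial.coeff I b := by
  classical
  induction b using MvPolynomial.induction_on' with
  | monomial J c =>
    rw [mode_one_conformalVector_monomial, MvPolynomial.coeff_smul, MvPolynomial.coeff_monomial,
      smul_eq_mul]
    split_ifs with h
    · rw [h]
    · rw [mul_zero, mul_zero]
  | add a b ha hb => rw [map_add, MvPolynomial.coeff_add, ha, hb, MvPolynomial.coeff_add, mul_add]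

theorem le_monomialWeight (I : ℕ →₀ ℕ) (k : ℕ) : I k * (k + 1) ≤ monomialWeight I := by
  by_cases hk : k ∈ I.support
  · exact Finset.single_le_sum (f := fun k => I k * (k + 1)) (fun _ _ => Nat.zero_le _) hk
  · rw [Finsupp.notMem_support_iff.1 hk, zero_mul]
    exact Nat.zero_le _

theorem finite_monomialWeight_eq (n : ℕ) : {I : ℕ →₀ ℕ | monomialWeight I = n}.Finite := by
  -- Weight `n` bounds every exponent by `n` and excludes the variables `X k` with k ≥ n.
  refine (Set.finite_Iic (Finsupp.indicator (Finset.range n) fun _ _ => n)).subset fun I hI k => ?_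
  have h := le_monomialWeight I k
  rw [show monomialWeight I = n from hI] at h
  rw [Finsupp.indicator_apply]
  split_ifs with hk
  · exact (Nat.le_mul_of_pos_right _ k.succ_pos).trans h
  · rw [Finset.mem_range, not_lt] at hk
    by_contra h0
    nlinarith [not_le.1 h0]

end HeisenbergFock

/-! ### Closed conditions and bounded families -/

section Limits

variable {V W : Type*} [NormedAddCommGroup V] [NormedAddCommGroup W]

/-- A uniformly Lipschitz family: an approximant within ε/2 divided by |C| + 1 moves every value by
less than ε/2. -/
theorem isClosed_setOf_tendsto_zero {ι : Type*} {l : Filter ι} {g : ι → V → W} {C : ℝ}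
    (hg : ∀ i x y, ‖g i x - g i y‖ ≤ C * ‖x - y‖) :
    IsClosed {x | Tendsto (fun i => g i x) l (𝓝 0)} := by
  refine isClosed_of_closure_subset fun x hx => ?_
  rw [Set.mem_ofPred_eq, Metric.tendsto_nhds]
  intro ε hε
  have hC : 0 < |C| + 1 := by positivity
  obtain ⟨y, hy, hxy⟩ := Metric.mem_closure_iff.1 hx (ε / 2 / (|C| + 1)) (by positivity)
  filter_upwards [Metric.tendsto_nhds.1 hy (ε / 2) (by positivity)] with i hi
  rw [dist_zero_right] at hi ⊢
  have h1 : ‖g i x - g i y‖ < ε / 2 := by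
    rw [dist_eq_norm, lt_div_iff₀ hC] at hxy
    refine (hg i x y).trans_lt (lt_of_le_of_lt ?_ hxy)
    rw [mul_comm]
    exact mul_le_mul_of_nonneg_left ((le_abs_self C).trans (by linarith)) (norm_nonneg _)
  calc ‖g i x‖ = ‖(g i x - g i y) + g i y‖ := by rw [sub_add_cancel]
    _ ≤ ‖g i x - g i y‖ + ‖g i y‖ := norm_add_le _ _
    _ < ε := by linarith

/-- Uniformly bounded families of additive maps: the condition that the sum of the values
converges to zero is closed. -/
theorem isClosed_setOf_hasSum_zero [IsUltrametricDist W] {g : ℕ → V → W} {C : ℝ}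
    (hC : 0 ≤ C) (hsub : ∀ i x y, g i (x - y) = g i x - g i y) (hg : ∀ i x, ‖g i x‖ ≤ C * ‖x‖) :
    IsClosed {x | HasSum (fun i => g i x) 0} := by
  have h := isClosed_setOf_tendsto_zero (l := (atTop : Filter (Finset ℕ)))
    (g := fun s x => ∑ i ∈ s, g i x) (C := C) fun s x y => by
      rw [← Finset.sum_sub_distrib]
      refine IsUltrametricDist.norm_sum_le_of_forall_le_of_nonneg (by positivity) fun i _ => ?_
      rw [← hsub]
      exact hg i _
  simpa only [HasSum, SummationFilter.unconditional_filter] using h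

theorem norm_zsmul_le_of_padic {p : ℕ} [Fact p.Prime] [NormedSpace ℚ_[p] V] (n : ℤ) (x : V) :
    ‖n • x‖ ≤ ‖x‖ := by
  rw [← Int.cast_smul_eq_zsmul ℚ_[p], norm_smul]
  exact mul_le_of_le_one_left (norm_nonneg x) (Padic.norm_int_le_one n)

/-- A uniformly bounded sequence of continuous linear maps, as a map to bounded sequences. -/
noncomputable def boundedFamily {𝕜 : Type*} [NontriviallyNormedField 𝕜] [NormedSpace 𝕜 V]
    [NormedSpace 𝕜 W] (M : ℤ → V →L[𝕜] W) (hM : ∀ n a, ‖M n a‖ ≤ ‖a‖) :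
    V →L[𝕜] BoundedContinuousFunction ℤ W :=
  LinearMap.mkContinuous
    { toFun := fun a =>
        BoundedContinuousFunction.ofNormedAddCommGroupDiscrete (fun n => M n a) ‖a‖ fun n => hM n a
      map_add' := fun a b => BoundedContinuousFunction.ext fun n => map_add (M n) a b
      map_smul' := fun c a => BoundedContinuousFunction.ext fun n => map_smul (M n) c a } 1
    fun a => by
      rw [one_mul]
      exact BoundedContinuousFunction.norm_ofNormedAddCommGroup_le _ (norm_nonneg a) fun n => hM n a

/-- The state-field correspondence with given modes. -/
noncomputable def padicFieldsOfModes {p : ℕ} [Fact p.Prime] [NormedSpace ℚ_[p] V]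
    (M : ℤ → V →L[ℚ_[p]] V →L[ℚ_[p]] V) (hM : ∀ n a b, ‖M n a b‖ ≤ ‖a‖ * ‖b‖)
    (hlim : ∀ a b, Tendsto (fun n => M n a b) atTop (𝓝 0)) : V →L[ℚ_[p]] PadicFields p V :=
  (boundedFamily M fun n a =>
    ContinuousLinearMap.opNorm_le_bound _ (norm_nonneg a) (hM n a)).codRestrict _ fun a b => hlim a b

end Limits

/-! ### The completion as a p-adic Banach space -/

namespace HeisenbergFock

variable {p : ℕ} [Fact p.Prime]

theorem toCompletion_add (a b : HeisenbergFock p) :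
    (a + b).toCompletion = a.toCompletion + b.toCompletion := by
  rw [toCompletion, map_add, UniformSpace.Completion.coe_add]
  rfl

/-- The canonical map from the Fock space to its completion, as a linear map. -/
noncomputable def toCompletionLin (p : ℕ) [Fact p.Prime] :
    HeisenbergFock p →ₗ[ℚ_[p]] HeisenbergCompletion p :=
  (UniformSpace.Completion.toComplL (𝕜 := ℚ_[p]) (E := NormedHeisenbergFock p)).toLinearMap.comp
    (NormedHeisenbergFock.ofFock p).toLinearMap

theorem toCompletionLin_apply (a : HeisenbergFock p) : toCompletionLin p a = a.toCompletion := rfl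

theorem norm_toCompletion (a : HeisenbergFock p) : ‖a.toCompletion‖ = supNorm a := by
  rw [toCompletion, UniformSpace.Completion.norm_coe, NormedHeisenbergFock.norm_ofFock]

theorem toCompletion_one : (1 : HeisenbergFock p).toCompletion = 1 := by
  rw [toCompletion, map_one, UniformSpace.Completion.coe_one]

/-- A closed property that holds on the Fock space holds on its completion. -/
theorem completion_induction {P : HeisenbergCompletion p → Prop} (hP : IsClosed {a | P a})
    (h : ∀ f : HeisenbergFock p, P f.toCompletion) (a : HeisenbergCompletion p) : P a :=
  UniformSpace.Completion.induction_on a hP fun f => by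
    have := h ((NormedHeisenbergFock.ofFock p).symm f)
    rwa [toCompletion, AlgEquiv.apply_symm_apply] at this

instance : IsUltrametricDist (HeisenbergCompletion p) := by
  refine IsUltrametricDist.isUltrametricDist_of_forall_norm_add_le_max_norm fun x y => ?_
  induction x using completion_induction with
  | hP => exact isClosed_le (by fun_prop) (by fun_prop)
  | h f =>
  induction y using completion_induction with
  | hP => exact isClosed_le (by fun_prop) (by fun_prop)
  | h g =>
    rw [← toCompletion_add, norm_toCompletion, norm_toCompletion, norm_toCompletion]
    exact supNorm_add_le_max f g

theorem exists_norm_sub_lt (v : HeisenbergCompletion p) {ε : ℝ} (hε : 0 < ε) :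
    ∃ f : HeisenbergFock p, ‖v - f.toCompletion‖ < ε := by
  obtain ⟨f, hf⟩ := Metric.denseRange_iff.1
    (UniformSpace.Completion.denseRange_coe (α := NormedHeisenbergFock p)) v ε hε
  refine ⟨(NormedHeisenbergFock.ofFock p).symm f, ?_⟩
  rwa [toCompletion, AlgEquiv.apply_symm_apply, ← dist_eq_norm]

theorem exists_coeff_norm_eq (f : HeisenbergFock p) : ∃ I, supNorm f = ‖f.coeff I‖ := by
  by_cases hf : f.support.Nonempty
  · obtain ⟨I, _, hI⟩ := Finset.exists_mem_eq_sup f.support hf fun I => ‖f.coeff I‖₊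
    exact ⟨I, by rw [supNorm, hI, coe_nnnorm]⟩
  · rw [Finset.not_nonempty_iff_eq_empty, MvPolynomial.support_eq_empty] at hf
    exact ⟨0, by rw [hf, supNorm_zero, MvPolynomial.coeff_zero, norm_zero]⟩

/-- In an ultrametric space an approximant closer to `v` than ‖v‖ has the same norm. Norms on S_1
are therefore norms of coefficients. -/
theorem exists_norm_sub_lt_norm {v : HeisenbergCompletion p} (hv : v ≠ 0) :
    ∃ f : HeisenbergFock p, ‖v - f.toCompletion‖ < ‖v‖ ∧ ‖v‖ = supNorm f := by
  obtain ⟨f, hf⟩ := exists_norm_sub_lt v (norm_pos_iff.2 hv)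
  refine ⟨f, hf, ?_⟩
  rw [← norm_toCompletion]
  refine le_antisymm ?_ ?_
  · have h := IsUltrametricDist.norm_add_le_max (v - f.toCompletion) f.toCompletion
    rw [sub_add_cancel] at h
    exact (le_max_iff.1 h).resolve_left hf.not_ge
  · have h := IsUltrametricDist.norm_add_le_max v (f.toCompletion - v)
    rw [add_sub_cancel, norm_sub_rev] at h
    exact h.trans (max_le le_rfl hf.le)

theorem isPadicBanachSpace_completion : IsPadicBanachSpace p (HeisenbergCompletion p) where
  complete := inferInstance
  ultrametric := inferInstance
  norm_mem v := by
    by_cases hv : v = 0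
    · exact ⟨0, by rw [hv, norm_zero, norm_zero]⟩
    · obtain ⟨f, _, hf⟩ := exists_norm_sub_lt_norm hv
      obtain ⟨I, hI⟩ := exists_coeff_norm_eq f
      exact ⟨_, hf.trans hI⟩

/-! ### Coefficients of elements of the completion -/

/-- The coefficient of a monomial, on the completion. -/
noncomputable def coeffCompletion (I : ℕ →₀ ℕ) : HeisenbergCompletion p →L[ℚ_[p]] ℚ_[p] :=
  (LinearMap.mkContinuous ((MvPolynomial.lcoeff ℚ_[p] I).comp
    (NormedHeisenbergFock.ofFock p).symm.toLinearMap) 1 fun f => by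
      rw [one_mul]
      exact norm_coeff_le _ I).extend UniformSpace.Completion.toComplL

theorem coeffCompletion_toCompletion (I : ℕ →₀ ℕ) (f : HeisenbergFock p) :
    coeffCompletion I f.toCompletion = f.coeff I :=
  ContinuousLinearMap.extend_eq _ UniformSpace.Completion.denseRange_coe
    (UniformSpace.Completion.isUniformInducing_coe _) _

theorem norm_coeffCompletion_le (I : ℕ →₀ ℕ) (v : HeisenbergCompletion p) :
    ‖coeffCompletion I v‖ ≤ ‖v‖ := by
  induction v using completion_induction with
  | hP => exact isClosed_le (by fun_prop) (by fun_prop)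
  | h f =>
    rw [coeffCompletion_toCompletion, norm_toCompletion]
    exact norm_coeff_le f I

/-- The largest coefficient of a good approximant has norm ‖v‖, too large to be lost in the error.
This makes weight spaces finite-dimensional. -/
theorem eq_zero_of_coeffCompletion_eq_zero {v : HeisenbergCompletion p}
    (hv : ∀ I, coeffCompletion I v = 0) : v = 0 := by
  by_contra hv0
  obtain ⟨f, hlt, heq⟩ := exists_norm_sub_lt_norm hv0
  obtain ⟨I, hI⟩ := exists_coeff_norm_eq f
  have h := norm_coeffCompletion_le I (v - f.toCompletion)
  rw [map_sub, hv, zero_sub, norm_neg, coeffCompletion_toCompletion, ← hI, ← heq] at h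
  exact hlt.not_ge h

/-! ### The products on the completion -/

/-- The `n`-th product on the Fock space as a continuous bilinear map with values in the
completion. -/
noncomputable def modeNormed (n : ℤ) :
    NormedHeisenbergFock p →L[ℚ_[p]] NormedHeisenbergFock p →L[ℚ_[p]] HeisenbergCompletion p :=
  LinearMap.mkContinuous₂
    (((mode n).compl₁₂ (NormedHeisenbergFock.ofFock p).symm.toLinearMap
      (NormedHeisenbergFock.ofFock p).symm.toLinearMap).compr₂ (toCompletionLin p)) 1 fun a b => by
        rw [one_mul]
        exact (norm_toCompletion _).le.trans (supNorm_mode_le n _ _)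

/-- The `n`-th product on the completion. -/
noncomputable def modeCompletion (n : ℤ) : HeisenbergCompletion p →L[ℚ_[p]]
    HeisenbergCompletion p →L[ℚ_[p]] HeisenbergCompletion p :=
  (((modeNormed n).extend UniformSpace.Completion.toComplL).flip.extend
    UniformSpace.Completion.toComplL).flip

theorem modeCompletion_toCompletion (n : ℤ) (a b : HeisenbergFock p) :
    modeCompletion n a.toCompletion b.toCompletion = (mode n a b).toCompletion := by
  rw [modeCompletion, ContinuousLinearMap.flip_apply]
  have e1 := fun f : NormedHeisenbergFock p →L[ℚ_[p]] NormedHeisenbergFock p →L[ℚ_[p]]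
      HeisenbergCompletion p => ContinuousLinearMap.extend_eq f
    (e := UniformSpace.Completion.toComplL)
    UniformSpace.Completion.denseRange_coe (UniformSpace.Completion.isUniformInducing_coe _)
    (NormedHeisenbergFock.ofFock p a)
  have e2 := fun f : NormedHeisenbergFock p →L[ℚ_[p]] HeisenbergCompletion p →L[ℚ_[p]]
      HeisenbergCompletion p => ContinuousLinearMap.extend_eq f
    (e := UniformSpace.Completion.toComplL)
    UniformSpace.Completion.denseRange_coe (UniformSpace.Completion.isUniformInducing_coe _)
    (NormedHeisenbergFock.ofFock p b)
  simp only [UniformSpace.Completion.coe_toComplL] at e1 e2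
  rw [toCompletion, toCompletion, e2, ContinuousLinearMap.flip_apply, e1]
  rfl

theorem norm_modeCompletion_le (n : ℤ) (a b : HeisenbergCompletion p) :
    ‖modeCompletion n a b‖ ≤ ‖a‖ * ‖b‖ := by
  induction a using completion_induction with
  | hP => exact isClosed_le (by fun_prop) (by fun_prop)
  | h a =>
  induction b using completion_induction with
  | hP => exact isClosed_le (by fun_prop) (by fun_prop)
  | h b =>
    rw [modeCompletion_toCompletion, norm_toCompletion, norm_toCompletion, norm_toCompletion]
    exact supNorm_mode_le n a b

theorem tendsto_modeCompletion (a b : HeisenbergCompletion p) :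
    Tendsto (fun n : ℤ => modeCompletion n a b) atTop (𝓝 0) := by
  induction a using completion_induction with
  | hP =>
    refine isClosed_setOf_tendsto_zero (g := fun n a => modeCompletion n a b) (C := ‖b‖)
      fun n x y => ?_
    rw [← sub_apply, ← map_sub, mul_comm]
    exact norm_modeCompletion_le n _ _
  | h a =>
  induction b using completion_induction with
  | hP =>
    refine isClosed_setOf_tendsto_zero (g := fun n b => modeCompletion n a.toCompletion b)
      (C := ‖a.toCompletion‖) fun n x y => ?_
    rw [← map_sub]
    exact norm_modeCompletion_le n _ _
  | h b =>
    obtain ⟨N, hN⟩ := exists_mode_eq_zero a b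
    refine tendsto_const_nhds.congr' ?_
    filter_upwards [eventually_ge_atTop N] with n hn
    rw [modeCompletion_toCompletion, hN n hn, ← toCompletionLin_apply, map_zero]

/-- The state-field correspondence on the completion. -/
noncomputable def vertexOperatorCompletion (p : ℕ) [Fact p.Prime] :
    HeisenbergCompletion p →L[ℚ_[p]] PadicFields p (HeisenbergCompletion p) :=
  padicFieldsOfModes modeCompletion norm_modeCompletion_le tendsto_modeCompletion

end HeisenbergFock

theorem continuous_padicField_apply {p : ℕ} [Fact p.Prime] {V : Type*} [NormedAddCommGroup V]
    [NormedSpace ℚ_[p] V] (Y : V →L[ℚ_[p]] PadicFields p V) (n : ℤ) (b : V) :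
    Continuous fun a => (Y a).1 n b :=
  ((continuous_eval_const n).comp
    (continuous_subtype_val.comp Y.continuous)).clm_apply continuous_const

namespace HeisenbergFock

variable {p : ℕ} [Fact p.Prime]

/-! ### The Jacobi identity on the completion -/

/-- The `i`-th term of the left-hand side of the Jacobi identity. -/
noncomputable def iterateTerm (r s t : ℤ) (u v w : HeisenbergCompletion p) (i : ℕ) :
    HeisenbergCompletion p :=
  Ring.choose r i • modeCompletion (r + s - i) (modeCompletion (t + i) u v) w

/-- The `i`-th term of the right-hand side of the Jacobi identity. -/
noncomputable def productTerm (r s t : ℤ) (u v w : HeisenbergCompletion p) (i : ℕ) :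
    HeisenbergCompletion p :=
  ((-1 : ℤ) ^ i * Ring.choose t i) •
    (modeCompletion (r + t - i) u (modeCompletion (s + i) v w)
      - (t.negOnePow : ℤ) • modeCompletion (s + t - i) v (modeCompletion (r + i) u w))

theorem norm_modeCompletion_modeCompletion_left_le (m n : ℤ) (u v w : HeisenbergCompletion p) :
    ‖modeCompletion m (modeCompletion n u v) w‖ ≤ ‖u‖ * ‖v‖ * ‖w‖ :=
  (norm_modeCompletion_le _ _ _).trans
    (mul_le_mul_of_nonneg_right (norm_modeCompletion_le _ _ _) (norm_nonneg w))

theorem norm_modeCompletion_modeCompletion_right_le (m n : ℤ) (u v w : HeisenbergCompletion p) :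
    ‖modeCompletion m u (modeCompletion n v w)‖ ≤ ‖u‖ * ‖v‖ * ‖w‖ := by
  rw [mul_assoc]
  exact (norm_modeCompletion_le _ _ _).trans
    (mul_le_mul_of_nonneg_left (norm_modeCompletion_le _ _ _) (norm_nonneg u))

theorem norm_iterateTerm_le (r s t : ℤ) (u v w : HeisenbergCompletion p) (i : ℕ) :
    ‖iterateTerm r s t u v w i‖ ≤ ‖u‖ * ‖v‖ * ‖w‖ :=
  (norm_zsmul_le_of_padic (p := p) _ _).trans (norm_modeCompletion_modeCompletion_left_le _ _ _ _ _)

theorem norm_sub_le_of_le {x y : HeisenbergCompletion p} {C : ℝ} (hx : ‖x‖ ≤ C) (hy : ‖y‖ ≤ C) :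
    ‖x - y‖ ≤ C := by
  rw [sub_eq_add_neg]
  exact (IsUltrametricDist.norm_add_le_max _ _).trans (max_le hx (by rwa [norm_neg]))

theorem norm_productTerm_le (r s t : ℤ) (u v w : HeisenbergCompletion p) (i : ℕ) :
    ‖productTerm r s t u v w i‖ ≤ ‖u‖ * ‖v‖ * ‖w‖ := by
  refine (norm_zsmul_le_of_padic (p := p) _ _).trans (norm_sub_le_of_le
    (norm_modeCompletion_modeCompletion_right_le _ _ _ _ _)
    ((norm_zsmul_le_of_padic (p := p) _ _).trans ?_))
  rw [mul_comm ‖u‖]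
  exact norm_modeCompletion_modeCompletion_right_le _ _ _ _ _

theorem norm_iterateTerm_sub_productTerm_le (r s t : ℤ) (u v w : HeisenbergCompletion p) (i : ℕ) :
    ‖iterateTerm r s t u v w i - productTerm r s t u v w i‖ ≤ ‖u‖ * ‖v‖ * ‖w‖ :=
  norm_sub_le_of_le (norm_iterateTerm_le _ _ _ _ _ _ _) (norm_productTerm_le _ _ _ _ _ _ _)

theorem toCompletion_sub (a b : HeisenbergFock p) :
    (a - b).toCompletion = a.toCompletion - b.toCompletion := map_sub (toCompletionLin p) a b

theorem toCompletion_zsmul (n : ℤ) (a : HeisenbergFock p) :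
    (n • a).toCompletion = n • a.toCompletion := map_zsmul (toCompletionLin p) n a

theorem toCompletion_smul (c : ℚ_[p]) (a : HeisenbergFock p) :
    (c • a).toCompletion = c • a.toCompletion := (toCompletionLin p).map_smul c a

theorem toCompletion_zero : (0 : HeisenbergFock p).toCompletion = 0 := map_zero (toCompletionLin p)

theorem iterateTerm_toCompletion (r s t : ℤ) (u v w : HeisenbergFock p) (i : ℕ) :
    iterateTerm r s t u.toCompletion v.toCompletion w.toCompletion i
      = ((1 ^ i * Ring.choose r i : ℤ) • mode (r + s - i) (mode (t + i) u v) w).toCompletion := by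
  rw [iterateTerm, modeCompletion_toCompletion, modeCompletion_toCompletion, toCompletion_zsmul,
    one_pow, one_mul]

theorem productTerm_toCompletion (r s t : ℤ) (u v w : HeisenbergFock p) (i : ℕ) :
    productTerm r s t u.toCompletion v.toCompletion w.toCompletion i
      = (((-1 : ℤ) ^ i * Ring.choose t i) • mode (t + r - i) u (mode (s + i) v w)
        - (t.negOnePow : ℤ) • ((-1 : ℤ) ^ i * Ring.choose t i)
          • mode (t + s - i) v (mode (r + i) u w)).toCompletion := by
  rw [smul_comm (t.negOnePow : ℤ), ← smul_sub, toCompletion_zsmul, toCompletion_sub,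
    toCompletion_zsmul, productTerm, add_comm r t, add_comm s t]
  simp only [modeCompletion_toCompletion]

theorem hasSum_jacobi_toCompletion (r s t : ℤ) (u v w : HeisenbergFock p) :
    HasSum (fun i => iterateTerm r s t u.toCompletion v.toCompletion w.toCompletion i
      - productTerm r s t u.toCompletion v.toCompletion w.toCompletion i) 0 := by
  obtain ⟨N1, h1⟩ := exists_mode_eq_zero u v
  obtain ⟨N2, h2⟩ := exists_mode_eq_zero v w
  obtain ⟨N3, h3⟩ := exists_mode_eq_zero u w
  set M := (N1 - t).toNat + (N2 - s).toNat + (N3 - r).toNat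
  have e1 : ∀ i : ℕ, M ≤ i → mode (t + i) u v = 0 := fun i hi => h1 _ (by omega)
  have e2 : ∀ i : ℕ, M ≤ i → mode (s + i) v w = 0 := fun i hi => h2 _ (by omega)
  have e3 : ∀ i : ℕ, M ≤ i → mode (r + i) u w = 0 := fun i hi => h3 _ (by omega)
  have hsum := jacobiDefect_eq_zero u v w r s t
  rw [jacobiDefect, iterateSum, productSum, productSum, binomialSum, binomialSum, binomialSum,
    finsum_eq_sum_range (N := M) fun i hi => by
      rw [e1 i hi, map_zero, LinearMap.zero_apply, smul_zero],
    finsum_eq_sum_range (N := M) fun i hi => by rw [e2 i hi, map_zero, smul_zero],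
    finsum_eq_sum_range (N := M) fun i hi => by rw [e3 i hi, map_zero, smul_zero],
    Finset.smul_sum, sub_add, ← Finset.sum_sub_distrib, ← Finset.sum_sub_distrib] at hsum
  simp only [iterateTerm_toCompletion, productTerm_toCompletion, ← toCompletion_sub]
  rw [← toCompletion_zero, ← hsum, ← toCompletionLin_apply (∑ i ∈ _, _), map_sum]
  refine hasSum_sum_of_ne_finset_zero fun i hi => ?_
  have hi : M ≤ i := by simpa using hi
  rw [e1 i hi, e2 i hi, e3 i hi]
  simp only [map_zero, LinearMap.zero_apply, smul_zero, sub_zero, toCompletion_zero]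

/-- The termwise difference is used because its sum is 0 whatever the arguments, which makes the
condition closed in each argument separately. -/
theorem hasSum_jacobi (r s t : ℤ) (u v w : HeisenbergCompletion p) :
    HasSum (fun i => iterateTerm r s t u v w i - productTerm r s t u v w i) 0 := by
  induction u using completion_induction with
  | hP =>
    refine isClosed_setOf_hasSum_zero
      (g := fun i u => iterateTerm r s t u v w i - productTerm r s t u v w i) (C := ‖v‖ * ‖w‖)
      (by positivity) (fun i x y => ?_) fun i x => ?_
    · simp only [iterateTerm, productTerm, map_sub, sub_apply, smul_sub]
      abel
    · rw [mul_comm, ← mul_assoc]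
      exact norm_iterateTerm_sub_productTerm_le r s t x v w i
  | h u =>
  induction v using completion_induction with
  | hP =>
    refine isClosed_setOf_hasSum_zero
      (g := fun i v => iterateTerm r s t u.toCompletion v w i - productTerm r s t u.toCompletion v w i)
      (C := ‖u.toCompletion‖ * ‖w‖) (by positivity) (fun i x y => ?_) fun i x => ?_
    · simp only [iterateTerm, productTerm, map_sub, sub_apply, smul_sub]
      abel
    · rw [mul_right_comm]
      exact norm_iterateTerm_sub_productTerm_le r s t _ x w i
  | h v =>
  induction w using completion_induction with
  | hP =>
    refine isClosed_setOf_hasSum_zero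
      (g := fun i w => iterateTerm r s t u.toCompletion v.toCompletion w i
        - productTerm r s t u.toCompletion v.toCompletion w i)
      (C := ‖u.toCompletion‖ * ‖v.toCompletion‖) (by positivity) (fun i x y => ?_) fun i x => ?_
    · simp only [iterateTerm, productTerm, map_sub, smul_sub]
      abel
    · exact norm_iterateTerm_sub_productTerm_le r s t _ _ x i
  | h w => exact hasSum_jacobi_toCompletion r s t u v w

/-- In a complete nonarchimedean group, terms tending to zero are summable; here u(t+i)v → 0 and the
outer modes are uniformly bounded. -/
theorem summable_iterateTerm (r s t : ℤ) (u v w : HeisenbergCompletion p) :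
    Summable (iterateTerm r s t u v w) := by
  refine NonarchimedeanAddGroup.summable_of_tendsto_cofinite_zero ?_
  rw [Nat.cofinite_eq_atTop]
  have h1 : Tendsto (fun i : ℕ => ‖modeCompletion (t + i) u v‖ * ‖w‖) atTop (𝓝 0) := by
    have h2 : Tendsto (fun i : ℕ => t + (i : ℤ)) atTop atTop :=
      tendsto_atTop_add_const_left _ _ tendsto_natCast_atTop_atTop
    simpa using ((tendsto_modeCompletion u v).comp h2).norm.mul_const ‖w‖
  exact squeeze_zero_norm (fun i => (norm_zsmul_le_of_padic (p := p) _ _).trans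
    (norm_modeCompletion_le _ _ _)) h1

theorem jacobi_completion (r s t : ℤ) (u v w : HeisenbergCompletion p) : ∃ x,
    HasSum (iterateTerm r s t u v w) x ∧ HasSum (productTerm r s t u v w) x := by
  obtain ⟨x, hx⟩ := summable_iterateTerm r s t u v w
  refine ⟨x, hx, ?_⟩
  simpa using hx.sub (hasSum_jacobi r s t u v w)

/-! ### The vertex operator algebra -/

theorem modeCompletion_one_right_of_nonneg (a : HeisenbergCompletion p) {n : ℤ} (hn : 0 ≤ n) :
    modeCompletion n a 1 = 0 := by
  induction a using completion_induction with
  | hP => exact isClosed_eq (by fun_prop) (by fun_prop)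
  | h a =>
    rw [← toCompletion_one, modeCompletion_toCompletion, mode_one_right_of_nonneg hn,
      toCompletion_zero]

theorem modeCompletion_neg_one_one_right (a : HeisenbergCompletion p) :
    modeCompletion (-1) a 1 = a := by
  induction a using completion_induction with
  | hP => exact isClosed_eq (by fun_prop) (by fun_prop)
  | h a => rw [← toCompletion_one, modeCompletion_toCompletion, mode_neg_one_one_right]

theorem modeCompletion_neg_one_one (a : HeisenbergCompletion p) :
    modeCompletion (-1) 1 a = a := by
  induction a using completion_induction with
  | hP => exact isClosed_eq (by fun_prop) (by fun_prop)
  | h a => rw [← toCompletion_one, modeCompletion_toCompletion, mode_one, if_pos rfl]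

/-- The vertex algebra structure on the completion. -/
noncomputable def vertexAlgebraCompletion (p : ℕ) [Fact p.Prime] :
    PadicVertexAlgebra p (HeisenbergCompletion p) where
  banach := isPadicBanachSpace_completion
  Y := vertexOperatorCompletion p
  vacuum := 1
  norm_vacuum_le := by
    rw [← toCompletion_one, norm_toCompletion]
    refine (supNorm_le_iff _ zero_le_one).2 fun I => ?_
    classical
    rw [MvPolynomial.coeff_one]
    split_ifs <;> simp
  creation_nonneg a _ hn := modeCompletion_one_right_of_nonneg a hn
  creation a := modeCompletion_neg_one_one_right a
  jacobi r s t u v w := jacobi_completion r s t u v w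

theorem virasoro_completion (m n : ℤ) (b : HeisenbergCompletion p) :
    modeCompletion (m + 1) (conformalVector p).toCompletion
        (modeCompletion (n + 1) (conformalVector p).toCompletion b)
      - modeCompletion (n + 1) (conformalVector p).toCompletion
        (modeCompletion (m + 1) (conformalVector p).toCompletion b)
      = (m - n) • modeCompletion (m + n + 1) (conformalVector p).toCompletion b
        + (if m + n = 0 then ((m : ℚ_[p]) ^ 3 - m) / 12 else 0) • b := by
  induction b using completion_induction with
  | hP =>
    exact isClosed_eq (by fun_prop) (((ContinuousLinearMap.continuous _).const_smul _).add
      (continuous_const_smul _))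
  | h b =>
    simp only [modeCompletion_toCompletion]
    rw [← toCompletion_sub, mode_conformalVector_commutator, toCompletion_add, toCompletion_zsmul,
      toCompletion_smul]

theorem translation_completion (v b : HeisenbergCompletion p) (n : ℤ) :
    modeCompletion 0 (conformalVector p).toCompletion (modeCompletion n v b)
      - modeCompletion n v (modeCompletion 0 (conformalVector p).toCompletion b)
      = (-n) • modeCompletion (n - 1) v b := by
  induction v using completion_induction with
  | hP => exact isClosed_eq (by fun_prop) (by fun_prop)
  | h v =>
  induction b using completion_induction with
  | hP => exact isClosed_eq (by fun_prop) (by fun_prop)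
  | h b =>
    simp only [modeCompletion_toCompletion]
    rw [← toCompletion_sub, mode_zero_conformalVector_mode, toCompletion_zsmul]

/-- The weakly conformal structure on the completion. -/
noncomputable def weaklyConformalCompletion (p : ℕ) [Fact p.Prime] :
    WeaklyConformalPadicVertexAlgebra p (HeisenbergCompletion p) where
  __ := vertexAlgebraCompletion p
  ω := (conformalVector p).toCompletion
  centralCharge := 1
  virasoro m n := by
    ext1 b
    rw [mul_one]
    exact virasoro_completion m n b
  translation_covariance v n := ContinuousLinearMap.ext fun b => translation_completion v b n

theorem mem_weightSpace_iff (k : ℤ) (v : HeisenbergCompletion p) :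
    v ∈ (weaklyConformalCompletion p).weightSpace k
      ↔ modeCompletion 1 (conformalVector p).toCompletion v = (k : ℚ_[p]) • v :=
  Module.End.mem_eigenspace_iff

theorem coeffCompletion_modeCompletion_one (I : ℕ →₀ ℕ) (v : HeisenbergCompletion p) :
    coeffCompletion I (modeCompletion 1 (conformalVector p).toCompletion v)
      = monomialWeight I * coeffCompletion I v := by
  induction v using completion_induction with
  | hP => exact isClosed_eq (by fun_prop) (by fun_prop)
  | h f =>
    rw [modeCompletion_toCompletion, coeffCompletion_toCompletion, coeffCompletion_toCompletion,
      coeff_mode_one_conformalVector]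

/-- Compare coefficients at `I` in L(0)v = kv; distinct integers stay distinct in characteristic
zero. -/
theorem coeffCompletion_eq_zero_of_mem_weightSpace {k : ℤ} {v : HeisenbergCompletion p}
    (hv : v ∈ (weaklyConformalCompletion p).weightSpace k) {I : ℕ →₀ ℕ}
    (hI : (monomialWeight I : ℤ) ≠ k) : coeffCompletion I v = 0 := by
  have h := coeffCompletion_modeCompletion_one I v
  rw [(mem_weightSpace_iff k v).1 hv, map_smul, smul_eq_mul, eq_comm, ← sub_eq_zero,
    ← sub_mul] at h
  refine (mul_eq_zero.1 h).resolve_left (sub_ne_zero.2 ?_)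
  exact_mod_cast hI

theorem finiteDimensional_weightSpace (k : ℤ) :
    FiniteDimensional ℚ_[p] ((weaklyConformalCompletion p).weightSpace k) := by
  have : Finite {I : ℕ →₀ ℕ | monomialWeight I = k.toNat} := finite_monomialWeight_eq k.toNat
  refine Module.Finite.of_injective ((LinearMap.pi fun I : {I : ℕ →₀ ℕ | monomialWeight I = k.toNat} =>
    ((coeffCompletion I.1 : HeisenbergCompletion p →L[ℚ_[p]] ℚ_[p]) :
      HeisenbergCompletion p →ₗ[ℚ_[p]] ℚ_[p])).comp
    ((weaklyConformalCompletion p).weightSpace k).subtype) ?_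
  rw [injective_iff_map_eq_zero]
  intro v hv
  refine Subtype.ext (eq_zero_of_coeffCompletion_eq_zero fun I => ?_)
  by_cases hI : (monomialWeight I : ℤ) = k
  · exact congrFun hv ⟨I, show monomialWeight I = k.toNat by omega⟩
  · exact coeffCompletion_eq_zero_of_mem_weightSpace v.2 hI

theorem weightSpace_eq_bot_of_neg {k : ℤ} (hk : k < 0) :
    (weaklyConformalCompletion p).weightSpace k = ⊥ := by
  rw [eq_bot_iff]
  exact fun v hv => (Submodule.mem_bot _).2 (eq_zero_of_coeffCompletion_eq_zero fun I =>
    coeffCompletion_eq_zero_of_mem_weightSpace hv (by omega))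

theorem toCompletion_mem_iSup_weightSpace (f : HeisenbergFock p) :
    f.toCompletion ∈ ⨆ k : ℤ, (weaklyConformalCompletion p).weightSpace k := by
  induction f using MvPolynomial.induction_on' with
  | monomial I c =>
    refine Submodule.mem_iSup_of_mem (monomialWeight I : ℤ) ((mem_weightSpace_iff _ _).2 ?_)
    rw [modeCompletion_toCompletion, mode_one_conformalVector_monomial, toCompletion_smul,
      Int.cast_natCast]
  | add f g hf hg =>
    rw [toCompletion_add]
    exact add_mem hf hg

theorem topologicalClosure_iSup_weightSpace :
    (⨆ k : ℤ, (weaklyConformalCompletion p).weightSpace k).topologicalClosure = ⊤ := by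
  refine eq_top_iff.2 fun v hv => ?_
  clear hv
  induction v using completion_induction with
  | hP =>
    exact Submodule.isClosed_topologicalClosure
      (⨆ k : ℤ, (weaklyConformalCompletion p).weightSpace k)
  | h f => exact Submodule.le_topologicalClosure _ (toCompletion_mem_iSup_weightSpace f)

/-- The vertex operator algebra structure on the completion. -/
noncomputable def padicVOACompletion (p : ℕ) [Fact p.Prime] :
    PadicVOA p (HeisenbergCompletion p) where
  __ := weaklyConformalCompletion p
  finite_weightSpace := finiteDimensional_weightSpace
  weight_bounded_below := ⟨0, fun _ hk => weightSpace_eq_bot_of_neg hk⟩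
  dense_weightSpace := topologicalClosure_iSup_weightSpace

theorem vertexOperator_unique (𝒲 : PadicVertexAlgebra p (HeisenbergCompletion p))
    (h𝒲 : ∀ (a b : HeisenbergFock p) (n : ℤ),
      𝒲.mode a.toCompletion n b.toCompletion = (a.modeProduct n b).toCompletion) :
    𝒲.Y = vertexOperatorCompletion p := by
  refine ContinuousLinearMap.ext fun a => Subtype.ext (BoundedContinuousFunction.ext fun n =>
    ContinuousLinearMap.ext fun b => ?_)
  induction a using completion_induction with
  | hP =>
    exact isClosed_eq (continuous_padicField_apply _ n b) (continuous_padicField_apply _ n b)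
  | h a =>
  induction b using completion_induction with
  | hP => exact isClosed_eq (ContinuousLinearMap.continuous _) (ContinuousLinearMap.continuous _)
  | h b => exact (h𝒲 a b n).trans (modeCompletion_toCompletion n a b).symm

end HeisenbergFock

/-- The Banach ring `S_1` carries a submultiplicative `p`-adic VOA structure with vacuum `1`,
conformal vector `ω = (1/2) h_{-1}^2` and central charge `1` that extends the products `a(n) b` of
the Heisenberg VOA `S`; its vacuum and vertex operators are determined by these products. -/
theorem mainTheorem3 (p : ℕ) [Fact p.Prime] :
    ∃ 𝒱 : PadicVOA p (HeisenbergCompletion p),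
      (∀ (a b : HeisenbergFock p) (n : ℤ),
        𝒱.mode a.toCompletion n b.toCompletion = (a.modeProduct n b).toCompletion) ∧
      𝒱.vacuum = 1 ∧
      𝒱.ω = (HeisenbergFock.conformalVector p).toCompletion ∧
      𝒱.centralCharge = 1 ∧
      𝒱.IsSubmultiplicative ∧
      ∀ 𝒲 : PadicVOA p (HeisenbergCompletion p),
        (∀ (a b : HeisenbergFock p) (n : ℤ),
          𝒲.mode a.toCompletion n b.toCompletion = (a.modeProduct n b).toCompletion) →
        𝒲.vacuum = 𝒱.vacuum ∧ 𝒲.Y = 𝒱.Y := by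
  refine ⟨HeisenbergFock.padicVOACompletion p,
    fun a b n => HeisenbergFock.modeCompletion_toCompletion n a b, rfl, rfl, rfl,
    fun a b n => HeisenbergFock.norm_modeCompletion_le n a b, fun 𝒲 h𝒲 => ?_⟩
  have hY := HeisenbergFock.vertexOperator_unique 𝒲.toPadicVertexAlgebra h𝒲
  refine ⟨?_, hY⟩
  -- The product 1(-1) is the identity by density, while the creation axiom says that it sends the
  -- vacuum to 1.
  have h := 𝒲.creation 1
  rw [hY] at h
  exact (HeisenbergFock.modeCompletion_neg_one_one 𝒲.vacuum).symm.trans h
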